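/- Let $\mathbb F$ be a field, let $a$ be an odd and $b$ an even non-negative integer, and put $n=a+b$ and $\lambda=(a,1^b)$. Let $\mathscr H$ be the Khovanov--Lauda--Rouquier algebra that is isomorphic to the Iwahori--Hecke algebra of $\mathfrak S_n$ over $\mathbb F$ at quantum characteristic $e=2$ (that is, $q=-1$). It is the unital associative $\mathbb F$-algebra with generators $y_1,\dots,y_n$, $\psi_1,\dots,\psi_{n-1}$, $e(i)$ $(i\in\{0,1\}^n)$ and relations \[ \begin{aligned} &y_1=0,\qquad e(i)=0\ \text{ if } i_1=1,\qquad e(i)e(j)=\delta_{ij}e(i),\qquad \textstyle\sum_i e(i)=1,\\ &y_re(i)=e(i)y_r,\qquad \psi_re(i)=e(s_r\cdot i)\psi_r,\qquad y_sy_r=y_ry_s,\qquad y_s\psi_r=\psi_ry_s\ \text{ if } s\neq r,r+1,\\ &y_r\psi_re(i)=(\psi_ry_{r+1}-\delta_{i_r,i_{r+1}})e(i),\qquad y_{r+1}\psi_re(i)=(\psi_ry_r+\delta_{i_r,i_{r+1}})e(i),\\ &\psi_s\psi_r=\psi_r\psi_s\ \text{ if } s\neq r\pm1,\\ &\psi_r^2e(i)=0\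 \text{ if } i_r=i_{r+1},\qquad \psi_r^2e(i)=-(y_r-y_{r+1})^2e(i)\ \text{ if } i_r\neq i_{r+1},\\ &\psi_r\psi_{r+1}\psi_re(i)=\psi_{r+1}\psi_r\psi_{r+1}e(i)\ \text{ if } i_r=i_{r+1}\text{ or }i_{r+1}=i_{r+2},\\ &\psi_r\psi_{r+1}\psi_re(i)=(\psi_{r+1}\psi_r\psi_{r+1}+y_r-2y_{r+1}+y_{r+2})e(i)\ \text{ if } i_r\neq i_{r+1}\neq i_{r+2}, \end{aligned} \] where $s_r=(r,r+1)$ acts on $i$ by swapping $i_r$ and $i_{r+1}$. A $\lambda$-tableau is a bijective filling of the Young diagram of $\lambda$ with $1,\dots,n$. Its leg consists of the nodes of the first column below the first row. The initial tableau $T_\lambda$ is the one whose entries are written consecutively down the columns. Let $i_\lambda\in\{0,1\}^n$ be its residue sequence: the $k$-th entry of $i_\lambda$ is $c-r$ modulo $2$, if $k$ lies in row $r$ and column $c$ of $T_\lambda$. The Specht module $S_{(a,1^b)}$ is the $\mathscr H$-module generated by $z$ subject to the relations $y_kz=0$ for all $k$, $e(i)z=\delta_{i,i_\lambda}z$ for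 all $i$, $\psi_jz=0$ for all $j\neq b+1$, and (if $a\geqslant 2$) $\psi_1\psi_2\cdots\psi_{b+1}z=0$. Fix for each $w\in\mathfrak S_n$ an arbitrary reduced expression $w=s_{r_1}\cdots s_{r_m}$ and put $\psi_w=\psi_{r_1}\cdots\psi_{r_m}$. For a standard $\lambda$-tableau $T$, let $w_T\in\mathfrak S_n$ be the permutation with $w_TT_\lambda=T$, and put $v_T=\psi_{w_T}z$. For odd $i,j$ with $3\leqslant i\leqslant b+1<j\leqslant n$, let $T_{i,j}$ be the standard $\lambda$-tableau whose leg contains exactly the entries of the pairs $\{[2,3],[4,5],\dots,[b,b+1],[j-1,j]\}\setminus\{[i-1,i]\}$. Then, for every such choice of reduced expressions, there exists an $\mathscr H$-module endomorphism $f$ of $S_{(a,1^b)}$ with \[ f(z)=\sum_{\substack{3\leqslant i\leqslant b+1,\ b+3\leqslant j\leqslant n\\ i,j\text{ odd}}}\frac{i-1}{2}\cdot\frac{n+2-j}{2}\,v_{T_{i,j}}. \] -/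

import Mathlib

namespace HookSpecht

/-! ## The KLR algebra for quantum characteristic two -/

/-- The positions `1, …, n`. -/
abbrev Pos (n : ℕ) : Type := Set.Icc 1 n

/-- The indices `1, …, n - 1` of the basic transpositions. -/
abbrev Idx (n : ℕ) : Type := Set.Ico 1 n

/-- The position `r`, for an index `1 ≤ r < n`. -/
def lo {n : ℕ} (r : Idx n) : Pos n := ⟨r.1, r.2.1, r.2.2.le⟩

/-- The position `r + 1`, for an index `1 ≤ r < n`. -/
def hi {n : ℕ} (r : Idx n) : Pos n := ⟨r.1 + 1, Nat.le_add_left 1 r.1, r.2.2⟩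

/-- The basic transposition `s_r = (r, r + 1)`. -/
def basicTransposition {n : ℕ} (r : Idx n) : Equiv.Perm (Pos n) :=
  Equiv.swap (lo r) (hi r)

/-- The generators `y_1, …, y_n`, `ψ_1, …, ψ_{n-1}` and `e(i)` for `i ∈ {0,1}^n`. -/
inductive KLRGen (n : ℕ) : Type
  | y (r : Pos n) : KLRGen n
  | psi (r : Idx n) : KLRGen n
  | e (i : Pos n → ZMod 2) : KLRGen n

section Relations

variable (F : Type*) [Field F] {n : ℕ}

/-- The generator `y_r` in the free algebra. -/
def yFree (r : Pos n) : FreeAlgebra F (KLRGen n) := FreeAlgebra.ι F (KLRGen.y r)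

/-- The generator `ψ_r` in the free algebra. -/
def psiFree (r : Idx n) : FreeAlgebra F (KLRGen n) := FreeAlgebra.ι F (KLRGen.psi r)

/-- The generator `e(i)` in the free algebra. -/
def eFree (i : Pos n → ZMod 2) : FreeAlgebra F (KLRGen n) := FreeAlgebra.ι F (KLRGen.e i)

/-- The defining relations of the (cyclotomic) KLR algebra with `e = 2`. -/
inductive KLRRel : FreeAlgebra F (KLRGen n) → FreeAlgebra F (KLRGen n) → Prop
  | y_one (r : Pos n) (hr : (r : ℕ) = 1) : KLRRel (yFree F r) 0
  | e_one (i : Pos n → ZMod 2) (r : Pos n) (hr : (r : ℕ) = 1) (h : i r = 1) :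
      KLRRel (eFree F i) 0
  | e_idem (i : Pos n → ZMod 2) : KLRRel (eFree F i * eFree F i) (eFree F i)
  | e_orth (i j : Pos n → ZMod 2) (h : i ≠ j) : KLRRel (eFree F i * eFree F j) 0
  | e_sum : KLRRel (∑ i : Pos n → ZMod 2, eFree F i) 1
  | y_e (r : Pos n) (i : Pos n → ZMod 2) :
      KLRRel (yFree F r * eFree F i) (eFree F i * yFree F r)
  | psi_e (r : Idx n) (i : Pos n → ZMod 2) :
      KLRRel (psiFree F r * eFree F i) (eFree F (i ∘ basicTransposition r) * psiFree F r)
  | y_y (r s : Pos n) : KLRRel (yFree F s * yFree F r) (yFree F r * yFree F s)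
  | y_psi (s : Pos n) (r : Idx n) (h : s ≠ lo r) (h' : s ≠ hi r) :
      KLRRel (yFree F s * psiFree F r) (psiFree F r * yFree F s)
  | y_psi_lo_ne (r : Idx n) (i : Pos n → ZMod 2) (h : i (lo r) ≠ i (hi r)) :
      KLRRel (yFree F (lo r) * psiFree F r * eFree F i)
        (psiFree F r * yFree F (hi r) * eFree F i)
  | y_psi_lo_eq (r : Idx n) (i : Pos n → ZMod 2) (h : i (lo r) = i (hi r)) :
      KLRRel (yFree F (lo r) * psiFree F r * eFree F i)
        ((psiFree F r * yFree F (hi r) - 1) * eFree F i)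
  | y_psi_hi_ne (r : Idx n) (i : Pos n → ZMod 2) (h : i (lo r) ≠ i (hi r)) :
      KLRRel (yFree F (hi r) * psiFree F r * eFree F i)
        (psiFree F r * yFree F (lo r) * eFree F i)
  | y_psi_hi_eq (r : Idx n) (i : Pos n → ZMod 2) (h : i (lo r) = i (hi r)) :
      KLRRel (yFree F (hi r) * psiFree F r * eFree F i)
        ((psiFree F r * yFree F (lo r) + 1) * eFree F i)
  | psi_psi (r s : Idx n) (h : (s : ℕ) ≠ r + 1) (h' : (r : ℕ) ≠ s + 1) :
      KLRRel (psiFree F s * psiFree F r) (psiFree F r * psiFree F s)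
  | psi_sq_eq (r : Idx n) (i : Pos n → ZMod 2) (h : i (lo r) = i (hi r)) :
      KLRRel (psiFree F r ^ 2 * eFree F i) 0
  | psi_sq_ne (r : Idx n) (i : Pos n → ZMod 2) (h : i (lo r) ≠ i (hi r)) :
      KLRRel (psiFree F r ^ 2 * eFree F i)
        (-(yFree F (lo r) - yFree F (hi r)) ^ 2 * eFree F i)
  | braid_eq (r r' : Idx n) (hr : (r' : ℕ) = r + 1) (i : Pos n → ZMod 2)
      (h : i (lo r) = i (hi r) ∨ i (hi r) = i (hi r')) :
      KLRRel (psiFree F r * psiFree F r' * psiFree F r * eFree F i)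
        (psiFree F r' * psiFree F r * psiFree F r' * eFree F i)
  | braid_ne (r r' : Idx n) (hr : (r' : ℕ) = r + 1) (i : Pos n → ZMod 2)
      (h : i (lo r) ≠ i (hi r)) (h' : i (hi r) ≠ i (hi r')) :
      KLRRel (psiFree F r * psiFree F r' * psiFree F r * eFree F i)
        ((psiFree F r' * psiFree F r * psiFree F r' + yFree F (lo r) - 2 * yFree F (hi r)
          + yFree F (hi r')) * eFree F i)

variable (n)

/-- The KLR algebra over `F` with `e = 2`, isomorphic to the Iwahori–Hecke algebra of the
symmetric group on `n` letters at `q = -1`. -/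
abbrev KLR : Type _ := RingQuot (KLRRel F (n := n))

variable {n}

/-- The element `y_r` of the KLR algebra. -/
def yElt (r : Pos n) : KLR F n := RingQuot.mkAlgHom F (KLRRel F) (yFree F r)

/-- The element `ψ_r` of the KLR algebra. -/
def psiElt (r : Idx n) : KLR F n := RingQuot.mkAlgHom F (KLRRel F) (psiFree F r)

/-- The element `e(i)` of the KLR algebra. -/
def eElt (i : Pos n → ZMod 2) : KLR F n := RingQuot.mkAlgHom F (KLRRel F) (eFree F i)

/-- The product `ψ_{r_1} ⋯ ψ_{r_m}` attached to a word `r_1, …, r_m`. -/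
def psiWord (l : List (Idx n)) : KLR F n := (l.map (psiElt F)).prod

end Relations

/-- `l = (r_1, …, r_m)` is a reduced expression of `w`: `w = s_{r_1} ⋯ s_{r_m}`, `m` minimal. -/
def IsReducedExpression {n : ℕ} (w : Equiv.Perm (Pos n)) (l : List (Idx n)) : Prop :=
  (l.map basicTransposition).prod = w ∧
    ∀ l' : List (Idx n), (l'.map basicTransposition).prod = w → l.length ≤ l'.length

/-! ## Hook partitions and their tableaux -/

/-- The parts of the hook partition `(a, 1^b)`, numbered from `1`. -/
def hookPart (a b i : ℕ) : ℕ := if i = 1 then a else if 2 ≤ i ∧ i ≤ b + 1 then 1 else 0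

/-- The nodes `(i, j)` (row `i`, column `j`, numbered from `1`) of the Young diagram of
`(a, 1^b)`. -/
abbrev HookNode (a b : ℕ) : Type :=
  {p : ℕ × ℕ // 1 ≤ p.1 ∧ 1 ≤ p.2 ∧ p.2 ≤ hookPart a b p.1}

/-- A tableau of shape `(a, 1^b)`: the nodes are filled bijectively with `1, …, a + b`. -/
abbrev HookTableau (a b : ℕ) : Type := HookNode a b ≃ Pos (a + b)

/-- Entries increase along the rows and down the columns. -/
def IsStandard {a b : ℕ} (T : HookTableau a b) : Prop :=
  ∀ p q : HookNode a b,
    (p.1.1 = q.1.1 ∧ p.1.2 < q.1.2 ∨ p.1.2 = q.1.2 ∧ p.1.1 < q.1.1) → T p < T q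

/-- The residue sequence of `T`: the node `(i, j)` has residue `j - i` modulo `2`. -/
def residueSequence {a b : ℕ} (T : HookTableau a b) : Pos (a + b) → ZMod 2 :=
  fun k => ((T.symm k).1.2 : ZMod 2) - ((T.symm k).1.1 : ZMod 2)

theorem hookNode_cases {a b : ℕ} (p : HookNode a b) :
    (p.1.1 = 1 ∧ 1 ≤ p.1.2 ∧ p.1.2 ≤ a) ∨ (2 ≤ p.1.1 ∧ p.1.1 ≤ b + 1 ∧ p.1.2 = 1) := by
  obtain ⟨⟨i, j⟩, h1, h2, h3⟩ := p
  simp only at h1 h2 h3 ⊢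
  unfold hookPart at h3
  split_ifs at h3 <;> omega

/-- The initial tableau: entries are written consecutively down the columns, so that
the first column holds `1, …, b + 1` and the node `(1, j)` with `j ≥ 2` holds `b + j`. -/
def initialTableau (a b : ℕ) (ha : 0 < a) : HookTableau a b where
  toFun p := ⟨if p.1.2 = 1 then p.1.1 else b + p.1.2, by
    have := hookNode_cases p
    split_ifs <;> constructor <;> omega⟩
  invFun k := ⟨if k.1 ≤ b + 1 then (k.1, 1) else (1, k.1 - b), by
    obtain ⟨k, h1, h2⟩ := k
    by_cases h : k ≤ b + 1
    · rw [if_pos h]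
      refine ⟨h1, le_refl 1, ?_⟩
      simp only [hookPart]
      split_ifs <;> omega
    · simp only [h, if_false, hookPart, if_true]
      exact ⟨le_refl 1, by omega, by omega⟩⟩
  left_inv p := by
    have := hookNode_cases p
    obtain ⟨⟨i, j⟩, hp⟩ := p
    apply Subtype.ext
    simp only at this ⊢
    split_ifs <;> ext <;> simp only <;> omega
  right_inv k := by
    obtain ⟨k, h1, h2⟩ := k
    apply Subtype.ext
    simp only
    split_ifs <;> simp_all <;> omega

/-- The entry of the node `p` in the tableau `T_{i,j}`: the leg holds, in increasing order,
the dominoes `[2,3], [4,5], …, [b,b+1], [j-1,j]` except `[i-1,i]`, and the arm holds the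
remaining entries in increasing order. -/
def dominoEntry (b i j : ℕ) (p : ℕ × ℕ) : ℕ :=
  if p.2 = 1 then
    (if p.1 < i - 1 then p.1 else if p.1 < b then p.1 + 2 else if p.1 = b then j - 1 else j)
  else
    (if p.2 = 2 then i - 1 else if p.2 = 3 then i
      else if b + p.2 ≤ j then b + p.2 - 2 else b + p.2)

/-- The pairs of odd integers `(i, j)` with `3 ≤ i ≤ b + 1` and `b + 3 ≤ j ≤ a + b`. -/
def oddPairs (a b : ℕ) : Finset (ℕ × ℕ) :=
  (Finset.Icc 3 (b + 1) ×ˢ Finset.Icc (b + 3) (a + b)).filter fun p => Odd p.1 ∧ Odd p.2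

theorem mem_oddPairs {a b : ℕ} {p : ℕ × ℕ} :
    p ∈ oddPairs a b ↔
      ((3 ≤ p.1 ∧ p.1 ≤ b + 1) ∧ (b + 3 ≤ p.2 ∧ p.2 ≤ a + b)) ∧ Odd p.1 ∧ Odd p.2 := by
  simp [oddPairs]

/-- The map from nodes to entries that defines `T_{i,j}`. -/
def dominoFun {a b : ℕ} (x : oddPairs a b) (p : HookNode a b) : Pos (a + b) :=
  ⟨dominoEntry b x.1.1 x.1.2 p.1, by
    have hx := mem_oddPairs.1 x.2
    have hp := hookNode_cases p
    simp only [dominoEntry]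
    split_ifs <;> constructor <;> omega⟩

theorem dominoFun_injective {a b : ℕ} (x : oddPairs a b) :
    Function.Injective (dominoFun x) := by
  intro p q h
  have hx := mem_oddPairs.1 x.2
  have hp := hookNode_cases p
  have hq := hookNode_cases q
  obtain ⟨⟨i, j⟩, hx'⟩ := x
  obtain ⟨⟨p1, p2⟩, hp'⟩ := p
  obtain ⟨⟨q1, q2⟩, hq'⟩ := q
  have h' := congrArg Subtype.val h
  simp only [dominoFun, dominoEntry] at h' hx hp hq
  apply Subtype.ext
  simp only [Prod.mk.injEq]
  grind

theorem dominoFun_bijective {a b : ℕ} (x : oddPairs a b) :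
    Function.Bijective (dominoFun x) := by
  have hx := mem_oddPairs.1 x.2
  have e := initialTableau a b (by omega)
  have h : Function.Injective (dominoFun x ∘ e.symm) :=
    (dominoFun_injective x).comp e.symm.injective
  have h2 := (Finite.injective_iff_bijective.1 h).2
  exact ⟨dominoFun_injective x, h2.of_comp⟩

/-- The tableau `T_{i,j}`. -/
noncomputable def dominoTableau {a b : ℕ} (x : oddPairs a b) : HookTableau a b :=
  Equiv.ofBijective (dominoFun x) (dominoFun_bijective x)

/-- `T_{i,j}` is standard. -/
theorem dominoTableau_isStandard {a b : ℕ} (x : oddPairs a b) :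
    IsStandard (dominoTableau x) := by
  intro p q h
  have hx := mem_oddPairs.1 x.2
  have hp := hookNode_cases p
  have hq := hookNode_cases q
  rw [← Subtype.coe_lt_coe]
  change dominoEntry b x.1.1 x.1.2 p.1 < dominoEntry b x.1.1 x.1.2 q.1
  simp only [dominoEntry]
  obtain ⟨⟨i, j⟩, hx'⟩ := x
  obtain ⟨⟨p1, p2⟩, hp'⟩ := p
  obtain ⟨⟨q1, q2⟩, hq'⟩ := q
  simp only at *
  grind

/-- The leg of `T_{i,j}` holds exactly the entries of the dominoes
`[2,3], [4,5], …, [b,b+1], [j-1,j]` except those of `[i-1,i]`. -/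
theorem dominoTableau_leg {a b : ℕ} (x : oddPairs a b) (k : Pos (a + b)) :
    2 ≤ ((dominoTableau x).symm k).1.1 ↔
      ((2 ≤ k.1 ∧ k.1 ≤ b + 1) ∨ k.1 = x.1.2 - 1 ∨ k.1 = x.1.2) ∧
        ¬(k.1 = x.1.1 - 1 ∨ k.1 = x.1.1) := by
  obtain ⟨p, rfl⟩ := (dominoTableau x).surjective k
  rw [Equiv.symm_apply_apply]
  have hx := mem_oddPairs.1 x.2
  have hp := hookNode_cases p
  have hk : (dominoTableau x p).1 = dominoEntry b x.1.1 x.1.2 p.1 := rfl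
  rw [hk]
  simp only [dominoEntry]
  obtain ⟨⟨i, j⟩, hx'⟩ := x
  obtain ⟨⟨p1, p2⟩, hp'⟩ := p
  simp only at *
  grind

/-- The permutation `w_T` with `w_T T_λ = T`, where `λ = (a, 1^b)`. -/
def tableauPerm {a b : ℕ} (ha : 0 < a) (T : HookTableau a b) : Equiv.Perm (Pos (a + b)) :=
  (initialTableau a b ha).symm.trans T

/-! ## The Specht module -/

section Specht

variable (F : Type*) [Field F] (a b : ℕ) (ha : 0 < a)

/-- The element `ψ_1 ψ_2 ⋯ ψ_{b+1}`, which exists when `b + 1 ≤ n - 1`. -/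
def garnirElt (h : b + 1 < a + b) : KLR F (a + b) :=
  psiWord F (List.ofFn fun k : Fin (b + 1) =>
    (⟨k.1 + 1, Nat.le_add_left 1 k.1, (Nat.succ_le_of_lt k.2).trans_lt h⟩ : Idx (a + b)))

open Classical in
/-- The elements of the KLR algebra that annihilate the generator `z` of `S_{(a,1^b)}`. -/
inductive SpechtRel : KLR F (a + b) → Prop
  | y (k : Pos (a + b)) : SpechtRel (yElt F k)
  | e (i : Pos (a + b) → ZMod 2) :
      SpechtRel (eElt F i - if i = residueSequence (initialTableau a b ha) then 1 else 0)
  | psi (j : Idx (a + b)) (hj : (j : ℕ) ≠ b + 1) : SpechtRel (psiElt F j)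
  | garnir (h : b + 1 < a + b) : SpechtRel (garnirElt F a b h)

/-- The left ideal generated by the relations of the Specht module. -/
def spechtIdeal : Submodule (KLR F (a + b)) (KLR F (a + b)) :=
  Submodule.span (KLR F (a + b)) {x | SpechtRel F a b ha x}

/-- The Specht module `S_{(a,1^b)}`: the module over the KLR algebra generated by `z` subject
to `y_k z = 0` for all `k`, `e(i) z = δ_{i,i_λ} z` for all `i`, `ψ_j z = 0` for all
`j ≠ b + 1`, and `ψ_1 ψ_2 ⋯ ψ_{b+1} z = 0`. -/
abbrev Specht : Type _ := KLR F (a + b) ⧸ spechtIdeal F a b ha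

/-- The generator `z` of the Specht module. -/
def spechtGen : Specht F a b ha := Submodule.Quotient.mk 1

variable {a b}

/-- The vector `v_T = ψ_{w_T} z`, where `pref w` is the preferred reduced expression of `w`. -/
def tableauVector (pref : Equiv.Perm (Pos (a + b)) → List (Idx (a + b)))
    (T : HookTableau a b) : Specht F a b ha :=
  psiWord F (pref (tableauPerm ha T)) • spechtGen F a b ha

end Specht

end HookSpecht

/-!
A homomorphism from the Specht module is the same as a vector `u` that satisfies the defining
relations of its generator `z`, so it has to be shown that these relations kill the given sum `u`.

Write `b = 2B` and `n = 2N + 1`, and call `[2k, 2k + 1]` the domino number `k`. As `b` is even, the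
residue sequence of `z` is the alternating one. Consider the vectors of this residue which are
killed by all `y_r` and by all `ψ_r` with `r` even (`IsDomino`); the generator `z` is one of them.
The KLR relations on four strands show that the operators `E_k = ψ_{2k+1} ψ_{2k} ψ_{2k+2} ψ_{2k+1}`
(`dominoOp`, which takes `2k` as its argument) preserve these vectors (`IsDomino.dominoOp`), and
that there the following identities of Temperley–Lieb type hold:

* `ψ_{2k+1} E_k x = -2 ψ_{2k+1} x` (`IsDomino.psi_dominoOp_self`),
* `ψ_{2k+1} E_{k+1} E_k x = ψ_{2k+1} x` if `ψ_{2k+3} x = 0`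
  (`IsDomino.psi_dominoOp_dominoOp_up`), and its mirror image
  (`IsDomino.psi_dominoOp_dominoOp_down`).

The vector of the tableau with the domino `I ≤ B` of the leg replaced by the domino `J > B` is
`E_I ⋯ E_{B-1} E_{J-1} ⋯ E_B z` (`dominoVec`). To see this for an arbitrary reduced expression, note
that the permutation is a shuffle of the first column and the arm. Reading a reduced expression
from the right, each letter moves an entry of the first column up past an entry of the arm; two
such steps possible at the same time are far apart, hence commute in the KLR algebra
(`IsShuffle.exists_step`), so the resulting vector depends on the permutation only
(`IsShuffle.psiWord_smul`).

Now `u = ∑ I (N + 1 - J) E_I ⋯ E_{B-1} E_{J-1} ⋯ E_B z`. For `k < B`, the identities above show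
that, for every `J`, the values of `ψ_{2k+1}` on the vectors with `I = k + 1, k, k - 1` are
`1, -2, 1` times one and the same vector, and all others are `0`; since the weight is linear in `I`,
the sum vanishes. The case `k > B` is the same with `J` in place of `I` (`psi_weightedSum`). Finally
`ψ_1 u` and the image of `u` under the Garnir element vanish because their residue sequences start
with `1`, where `e(i) = 0` (`smul_eq_zero_of_rel`).
-/

namespace HookSpecht

/-! ### The relations of the KLR algebra acting on a module -/

section Algebra

variable (F : Type*) [Field F] (n : ℕ)

/-- The element `ψ_r`, for an arbitrary natural number `r`; it is `0` unless `1 ≤ r < n`. -/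
def psiN (r : ℕ) : KLR F n := if h : r ∈ Set.Ico 1 n then psiElt F ⟨r, h⟩ else 0

/-- The element `y_r`, for an arbitrary natural number `r`; it is `0` unless `1 ≤ r ≤ n`. -/
def yN (r : ℕ) : KLR F n := if h : r ∈ Set.Icc 1 n then yElt F ⟨r, h⟩ else 0

variable {M : Type*} [AddCommGroup M] [Module (KLR F n) M]

/-- The vector `x` has residue sequence `c`, that is `e(c) x = x`. Only the values of `c` on
`1, …, n` matter. -/
def HasRes (c : ℕ → ZMod 2) (x : M) : Prop := eElt F (fun p : Pos n => c p) • x = x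

local notation "ψ" => psiN F n
local notation "y" => yN F n

/-- The sequence `c` with the entries at the positions `r` and `r + 1` interchanged. -/
def swapRes (r : ℕ) (c : ℕ → ZMod 2) (p : ℕ) : ZMod 2 :=
  if p = r then c (r + 1) else if p = r + 1 then c r else c p

variable {F n}

theorem mkAlgHom_eq_of_rel {u v : FreeAlgebra F (KLRGen n)} (h : KLRRel F u v) :
    RingQuot.mkAlgHom F (KLRRel F) u = RingQuot.mkAlgHom F (KLRRel F) v :=
  RingQuot.mkAlgHom_rel F h

theorem swapRes_eq_comp (c : ℕ → ZMod 2) (r : Idx n) :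
    (fun p : Pos n => swapRes r c p) = (fun p : Pos n => c p) ∘ basicTransposition r := by
  funext p
  simp only [swapRes, Function.comp, basicTransposition, Equiv.swap_apply_def, Subtype.ext_iff,
    lo, hi]
  split_ifs <;> rfl

theorem psiN_of_mem {r : ℕ} (h : r ∈ Set.Ico 1 n) : ψ r = psiElt F ⟨r, h⟩ := dif_pos h

theorem yN_of_mem {r : ℕ} (h : r ∈ Set.Icc 1 n) : y r = yElt F ⟨r, h⟩ := dif_pos h

theorem HasRes.psi {c : ℕ → ZMod 2} {x : M} (hx : HasRes F n c x) (r : ℕ) :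
    HasRes F n (swapRes r c) (ψ r • x) := by
  by_cases h : r ∈ Set.Ico 1 n
  · have key := mkAlgHom_eq_of_rel (F := F) (KLRRel.psi_e ⟨r, h⟩ (fun p : Pos n => c p))
    simp only [map_mul] at key
    change psiElt F _ * eElt F _ = eElt F _ * psiElt F _ at key
    unfold HasRes
    rw [swapRes_eq_comp c ⟨r, h⟩, psiN_of_mem h, ← mul_smul, ← key, mul_smul, hx]
  · simp [HasRes, psiN, h]

theorem HasRes.congr {c c' : ℕ → ZMod 2} {x : M} (hx : HasRes F n c x)
    (h : ∀ p, 1 ≤ p → p ≤ n → c p = c' p) : HasRes F n c' x := by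
  have : (fun p : Pos n => c' p) = fun p : Pos n => c p :=
    funext fun p => (h p p.2.1 p.2.2).symm
  unfold HasRes
  rwa [this]

/-- A vector whose residue sequence starts with `1` vanishes. -/
theorem HasRes.eq_zero {c : ℕ → ZMod 2} {x : M} (hx : HasRes F n c x) (hn : 1 ≤ n)
    (h : c 1 = 1) : x = 0 := by
  have key := mkAlgHom_eq_of_rel (F := F)
    (KLRRel.e_one (fun p : Pos n => c p) ⟨1, le_refl 1, hn⟩ rfl h)
  rw [map_zero] at key
  rw [← hx]
  change RingQuot.mkAlgHom F (KLRRel F) _ • x = 0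
  rw [key, zero_smul]

theorem psiN_mul_comm {r s : ℕ} (h : s ≠ r + 1) (h' : r ≠ s + 1) : ψ s * ψ r = ψ r * ψ s := by
  by_cases hr : r ∈ Set.Ico 1 n
  · by_cases hs : s ∈ Set.Ico 1 n
    · have key := mkAlgHom_eq_of_rel (F := F) (KLRRel.psi_psi ⟨r, hr⟩ ⟨s, hs⟩ h h')
      simp only [map_mul] at key
      rw [psiN_of_mem hr, psiN_of_mem hs]
      exact key
    · simp [psiN, hs]
  · simp [psiN, hr]

theorem psiN_smul_comm {r s : ℕ} (h : s ≠ r + 1) (h' : r ≠ s + 1) (x : M) :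
    ψ s • ψ r • x = ψ r • ψ s • x := by
  rw [← mul_smul, ← mul_smul, psiN_mul_comm h h']

theorem yN_smul_psiN_comm {r s : ℕ} (h : s ≠ r) (h' : s ≠ r + 1) (x : M) :
    y s • ψ r • x = ψ r • y s • x := by
  rw [← mul_smul, ← mul_smul]
  congr 1
  by_cases hr : r ∈ Set.Ico 1 n
  · by_cases hs : s ∈ Set.Icc 1 n
    · have key := mkAlgHom_eq_of_rel (F := F) (KLRRel.y_psi ⟨s, hs⟩ ⟨r, hr⟩
        (fun e => h (congrArg Subtype.val e)) (fun e => h' (congrArg Subtype.val e)))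
      simp only [map_mul] at key
      rw [psiN_of_mem hr, yN_of_mem hs]
      exact key
    · simp [yN, hs]
  · simp [psiN, hr]

section Local

variable {c : ℕ → ZMod 2} {x : M} {r : ℕ}

theorem yN_lo (hr : 1 ≤ r) (hn : r + 1 ≤ n) :
    y r = RingQuot.mkAlgHom F (KLRRel F) (yFree F (lo (⟨r, hr, hn⟩ : Idx n))) :=
  yN_of_mem (F := F) (r := r) ⟨hr, by omega⟩

theorem yN_hi (hr : 1 ≤ r) (hn : r + 1 ≤ n) :
    y (r + 1) = RingQuot.mkAlgHom F (KLRRel F) (yFree F (hi (⟨r, hr, hn⟩ : Idx n))) :=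
  yN_of_mem (F := F) (r := r + 1) ⟨by omega, hn⟩

theorem psiN_eq_mk (hr : 1 ≤ r) (hn : r + 1 ≤ n) :
    ψ r = RingQuot.mkAlgHom F (KLRRel F) (psiFree F (⟨r, hr, hn⟩ : Idx n)) :=
  psiN_of_mem (F := F) ⟨hr, hn⟩

/-- A relation `u e(c) = v e(c)` gives `u x = v x` for every vector `x` of residue `c`. -/
theorem HasRes.smul_congr (hx : HasRes F n c x) {u v : FreeAlgebra F (KLRGen n)}
    (h : KLRRel F (u * eFree F fun p : Pos n => c p) (v * eFree F fun p : Pos n => c p)) :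
    RingQuot.mkAlgHom F (KLRRel F) u • x = RingQuot.mkAlgHom F (KLRRel F) v • x := by
  have key := mkAlgHom_eq_of_rel (F := F) h
  simp only [map_mul] at key
  have hx' : RingQuot.mkAlgHom F (KLRRel F) (eFree F fun p : Pos n => c p) • x = x := hx
  rw [← hx', ← mul_smul, key, mul_smul]

theorem y_lo_psi_ne (hx : HasRes F n c x) (hr : 1 ≤ r) (hn : r + 1 ≤ n) (h : c r ≠ c (r + 1)) :
    y r • ψ r • x = ψ r • y (r + 1) • x := by
  have key := hx.smul_congr (KLRRel.y_psi_lo_ne ⟨r, hr, hn⟩ _ h)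
  simp only [map_mul] at key
  rwa [← psiN_eq_mk hr hn, ← yN_lo hr hn, ← yN_hi hr hn, mul_smul, mul_smul] at key

theorem y_lo_psi_eq (hx : HasRes F n c x) (hr : 1 ≤ r) (hn : r + 1 ≤ n) (h : c r = c (r + 1)) :
    y r • ψ r • x = ψ r • y (r + 1) • x - x := by
  have key := hx.smul_congr (KLRRel.y_psi_lo_eq ⟨r, hr, hn⟩ _ h)
  simp only [map_mul, map_sub, map_one] at key
  rwa [← psiN_eq_mk hr hn, ← yN_lo hr hn, ← yN_hi hr hn, mul_smul, sub_smul, mul_smul,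
    one_smul] at key

theorem y_hi_psi_ne (hx : HasRes F n c x) (hr : 1 ≤ r) (hn : r + 1 ≤ n) (h : c r ≠ c (r + 1)) :
    y (r + 1) • ψ r • x = ψ r • y r • x := by
  have key := hx.smul_congr (KLRRel.y_psi_hi_ne ⟨r, hr, hn⟩ _ h)
  simp only [map_mul] at key
  rwa [← psiN_eq_mk hr hn, ← yN_lo hr hn, ← yN_hi hr hn, mul_smul, mul_smul] at key

theorem y_hi_psi_eq (hx : HasRes F n c x) (hr : 1 ≤ r) (hn : r + 1 ≤ n) (h : c r = c (r + 1)) :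
    y (r + 1) • ψ r • x = ψ r • y r • x + x := by
  have key := hx.smul_congr (KLRRel.y_psi_hi_eq ⟨r, hr, hn⟩ _ h)
  simp only [map_mul, map_add, map_one] at key
  rwa [← psiN_eq_mk hr hn, ← yN_lo hr hn, ← yN_hi hr hn, mul_smul, add_smul, mul_smul,
    one_smul] at key

theorem psi_psi_ne (hx : HasRes F n c x) (hr : 1 ≤ r) (hn : r + 1 ≤ n) (h : c r ≠ c (r + 1)) :
    ψ r • ψ r • x = -((y r - y (r + 1)) • (y r - y (r + 1)) • x) := by
  have key := hx.smul_congr (KLRRel.psi_sq_ne ⟨r, hr, hn⟩ _ h)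
  simp only [map_pow, map_neg, map_sub] at key
  rwa [← psiN_eq_mk hr hn, ← yN_lo hr hn, ← yN_hi hr hn, neg_smul, sq, sq, mul_smul,
    mul_smul] at key

theorem braid_eq (hx : HasRes F n c x) (hr : 1 ≤ r) (hn : r + 2 ≤ n)
    (h : c r = c (r + 1) ∨ c (r + 1) = c (r + 2)) :
    ψ r • ψ (r + 1) • ψ r • x = ψ (r + 1) • ψ r • ψ (r + 1) • x := by
  have key := hx.smul_congr
    (KLRRel.braid_eq ⟨r, hr, by omega⟩ ⟨r + 1, by omega, hn⟩ rfl _ h)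
  simp only [map_mul] at key
  rwa [← psiN_eq_mk hr (by omega), ← psiN_eq_mk (by omega) hn, mul_smul, mul_smul, mul_smul,
    mul_smul] at key

theorem braid_ne (hx : HasRes F n c x) (hr : 1 ≤ r) (hn : r + 2 ≤ n)
    (h : c r ≠ c (r + 1)) (h' : c (r + 1) ≠ c (r + 2)) :
    ψ r • ψ (r + 1) • ψ r • x = ψ (r + 1) • ψ r • ψ (r + 1) • x
      + y r • x - (2 : ℤ) • y (r + 1) • x + y (r + 2) • x := by
  have key := hx.smul_congr
    (KLRRel.braid_ne ⟨r, hr, by omega⟩ ⟨r + 1, by omega, hn⟩ rfl _ h h')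
  have h3 : y (r + 2) = RingQuot.mkAlgHom F (KLRRel F)
      (yFree F (hi (⟨r + 1, by omega, hn⟩ : Idx n))) := yN_hi (by omega) hn
  simp only [map_mul, map_add, map_sub, map_ofNat] at key
  rw [← psiN_eq_mk hr (by omega), ← psiN_eq_mk (by omega) hn, ← yN_lo hr (by omega),
    ← yN_hi hr (by omega), ← h3] at key
  simp only [mul_smul, add_smul, sub_smul] at key
  rw [key, ofNat_smul_eq_nsmul, two_smul, two_smul]

end Local

/-! ### Vectors of alternating residue and the domino operators -/

/-- The alternating residue sequence `0, 1, 0, 1, …` (at the positions `1, 2, 3, 4, …`). -/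
def altRes (p : ℕ) : ZMod 2 := (p : ZMod 2) + 1

@[simp]
theorem altRes_add_two (p : ℕ) : altRes (p + 2) = altRes p := by
  have : (2 : ZMod 2) = 0 := rfl
  simp [altRes, this]

@[simp]
theorem altRes_ne (p : ℕ) : altRes p ≠ altRes (p + 1) := by
  simp [altRes]

@[simp]
theorem altRes_ne' (p : ℕ) : altRes (p + 1) ≠ altRes p := (altRes_ne p).symm

@[simp]
theorem altRes_add_three (p : ℕ) : altRes (p + 3) = altRes (p + 1) := altRes_add_two (p + 1)

@[simp]
theorem altRes_add_four (p : ℕ) : altRes (p + 4) = altRes p := by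
  rw [← altRes_add_two p, ← altRes_add_two (p + 2)]

variable (F n) in
/-- The domino operator `ψ_{r+1} ψ_r ψ_{r+2} ψ_{r+1}`, which interchanges the pairs of adjacent
positions `r, r + 1` and `r + 2, r + 3`. -/
def dominoOp (r : ℕ) : KLR F n := ψ (r + 1) * ψ r * ψ (r + 2) * ψ (r + 1)

local notation "E" => dominoOp F n

theorem dominoOp_smul (r : ℕ) (x : M) :
    E r • x = ψ (r + 1) • ψ r • ψ (r + 2) • ψ (r + 1) • x := by
  simp only [dominoOp, mul_smul]

theorem psiN_smul_dominoOp_comm {r s : ℕ} (h : s + 2 ≤ r ∨ r + 4 ≤ s) (x : M) :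
    ψ s • E r • x = E r • ψ s • x := by
  rw [dominoOp_smul, dominoOp_smul, psiN_smul_comm (by omega) (by omega),
    psiN_smul_comm (s := s) (r := r) (by omega) (by omega),
    psiN_smul_comm (s := s) (r := r + 2) (by omega) (by omega),
    psiN_smul_comm (s := s) (r := r + 1) (by omega) (by omega)]

theorem dominoOp_smul_comm {r s : ℕ} (h : r + 4 ≤ s) (x : M) :
    E s • E r • x = E r • E s • x := by
  rw [dominoOp_smul s, dominoOp_smul s,
    psiN_smul_dominoOp_comm (by omega), psiN_smul_dominoOp_comm (by omega),
    psiN_smul_dominoOp_comm (by omega), psiN_smul_dominoOp_comm (by omega)]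

variable (F n) in
/-- Domino vectors: vectors of alternating residue that are killed by all `y_r` and by all `ψ_r`
with `r` even. -/
structure IsDomino (x : M) : Prop where
  res : HasRes F n altRes x
  y_smul : ∀ r, y r • x = 0
  psi_smul : ∀ r, Even r → ψ r • x = 0

section Four

variable {x : M} {r : ℕ}

/-! The next lemmas compute the action of the `y_s` on the vectors `ψ_{r+1} x`,
`ψ_{r+2} ψ_{r+1} x`, `ψ_r ψ_{r+1} x` and `ψ_r ψ_{r+2} ψ_{r+1} x` for a domino vector `x`. The
relations for `y_s ψ_{r+1}` have no correction term, as the residues at `r + 1` and `r + 2` differ;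
after that, the residues at `r, r + 1` agree and so do those at `r + 2, r + 3`. -/

theorem IsDomino.y_psi (hx : IsDomino F n x) (h1 : 1 ≤ r) (hn : r + 3 ≤ n) (s : ℕ) :
    y s • ψ (r + 1) • x = 0 := by
  by_cases hs : s = r + 1
  · subst hs
    rw [y_lo_psi_ne hx.res (by omega) (by omega) (by simp), hx.y_smul, smul_zero]
  · by_cases hs' : s = r + 2
    · subst hs'
      rw [y_hi_psi_ne hx.res (by omega) (by omega) (by simp), hx.y_smul, smul_zero]
    · rw [yN_smul_psiN_comm (by omega) (by omega), hx.y_smul, smul_zero]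

/-- The product `ψ_{r+1} ψ_{r+2} ψ_{r+1}` kills a domino vector, because of the braid relation. -/
theorem IsDomino.braid_right (hx : IsDomino F n x) (h1 : 1 ≤ r) (hn : r + 3 ≤ n)
    (he : Even r) : ψ (r + 1) • ψ (r + 2) • ψ (r + 1) • x = 0 := by
  rw [braid_ne hx.res (by omega) (by omega) (by simp) (by simp),
    hx.psi_smul (r + 2) (by simpa [parity_simps] using he)]
  simp [hx.y_smul]

/-- The mirror image of `IsDomino.braid_right`. -/
theorem IsDomino.braid_left (hx : IsDomino F n x) (h1 : 1 ≤ r) (hn : r + 3 ≤ n)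
    (he : Even r) : ψ (r + 1) • ψ r • ψ (r + 1) • x = 0 := by
  have := braid_ne hx.res (r := r) (by omega) (by omega) (by simp) (by simp)
  rw [hx.psi_smul r he] at this
  simpa [hx.y_smul] using this.symm

theorem IsDomino.y_psi_right_lo (hx : IsDomino F n x) (h1 : 1 ≤ r) (hn : r + 3 ≤ n) :
    y (r + 2) • ψ (r + 2) • ψ (r + 1) • x = -(ψ (r + 1) • x) := by
  rw [y_lo_psi_eq (hx.res.psi _) (by omega) (by omega)
    (by simp [swapRes, add_assoc]), hx.y_psi h1 hn, smul_zero, zero_sub]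

theorem IsDomino.y_psi_right_hi (hx : IsDomino F n x) (h1 : 1 ≤ r) (hn : r + 3 ≤ n) :
    y (r + 3) • ψ (r + 2) • ψ (r + 1) • x = ψ (r + 1) • x := by
  rw [y_hi_psi_eq (r := r + 2) (hx.res.psi _) (by omega) (by omega)
    (by simp [swapRes, add_assoc]), hx.y_psi h1 hn, smul_zero, zero_add]

theorem IsDomino.y_psi_right_of_ne (hx : IsDomino F n x) (h1 : 1 ≤ r) (hn : r + 3 ≤ n) {s : ℕ}
    (hs : s ≠ r + 2) (hs' : s ≠ r + 3) : y s • ψ (r + 2) • ψ (r + 1) • x = 0 := by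
  rw [yN_smul_psiN_comm hs hs', hx.y_psi h1 hn, smul_zero]

theorem IsDomino.y_psi_left_lo (hx : IsDomino F n x) (h1 : 1 ≤ r) (hn : r + 3 ≤ n) :
    y r • ψ r • ψ (r + 1) • x = -(ψ (r + 1) • x) := by
  rw [y_lo_psi_eq (hx.res.psi _) (by omega) (by omega)
    (by simp [swapRes, add_assoc]), hx.y_psi h1 hn, smul_zero, zero_sub]

theorem IsDomino.y_psi_left_hi (hx : IsDomino F n x) (h1 : 1 ≤ r) (hn : r + 3 ≤ n) :
    y (r + 1) • ψ r • ψ (r + 1) • x = ψ (r + 1) • x := by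
  rw [y_hi_psi_eq (hx.res.psi _) (by omega) (by omega)
    (by simp [swapRes, add_assoc]), hx.y_psi h1 hn, smul_zero, zero_add]

theorem IsDomino.y_psi_left_of_ne (hx : IsDomino F n x) (h1 : 1 ≤ r) (hn : r + 3 ≤ n) {s : ℕ}
    (hs : s ≠ r) (hs' : s ≠ r + 1) : y s • ψ r • ψ (r + 1) • x = 0 := by
  rw [yN_smul_psiN_comm hs hs', hx.y_psi h1 hn, smul_zero]

theorem IsDomino.y_three_zero (hx : IsDomino F n x) (h1 : 1 ≤ r) (hn : r + 3 ≤ n) :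
    y r • ψ r • ψ (r + 2) • ψ (r + 1) • x = -(ψ (r + 2) • ψ (r + 1) • x) := by
  rw [y_lo_psi_eq ((hx.res.psi _).psi _) (by omega) (by omega)
    (by simp [swapRes, add_assoc]), hx.y_psi_right_of_ne h1 hn (by omega) (by omega),
    smul_zero, zero_sub]

theorem IsDomino.y_three_one (hx : IsDomino F n x) (h1 : 1 ≤ r) (hn : r + 3 ≤ n) :
    y (r + 1) • ψ r • ψ (r + 2) • ψ (r + 1) • x = ψ (r + 2) • ψ (r + 1) • x := by
  rw [y_hi_psi_eq ((hx.res.psi _).psi _) (by omega) (by omega)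
    (by simp [swapRes, add_assoc]), hx.y_psi_right_of_ne h1 hn (by omega) (by omega),
    smul_zero, zero_add]

theorem IsDomino.y_three_two (hx : IsDomino F n x) (h1 : 1 ≤ r) (hn : r + 3 ≤ n) :
    y (r + 2) • ψ r • ψ (r + 2) • ψ (r + 1) • x = -(ψ r • ψ (r + 1) • x) := by
  rw [yN_smul_psiN_comm (by omega) (by omega), hx.y_psi_right_lo h1 hn, smul_neg]

theorem IsDomino.y_three_three (hx : IsDomino F n x) (h1 : 1 ≤ r) (hn : r + 3 ≤ n) :
    y (r + 3) • ψ r • ψ (r + 2) • ψ (r + 1) • x = ψ r • ψ (r + 1) • x := by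
  rw [yN_smul_psiN_comm (by omega) (by omega), hx.y_psi_right_hi h1 hn]

theorem IsDomino.y_three_of_lt_or_lt (hx : IsDomino F n x) (h1 : 1 ≤ r) (hn : r + 3 ≤ n) {s : ℕ}
    (hs : s < r ∨ r + 3 < s) : y s • ψ r • ψ (r + 2) • ψ (r + 1) • x = 0 := by
  rw [yN_smul_psiN_comm (by omega) (by omega),
    hx.y_psi_right_of_ne h1 hn (by omega) (by omega), smul_zero]

theorem IsDomino.y_dominoOp (hx : IsDomino F n x) (h1 : 1 ≤ r) (hn : r + 3 ≤ n) (he : Even r)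
    (s : ℕ) : y s • E r • x = 0 := by
  have hres := ((hx.res.psi (r + 1)).psi (r + 2)).psi r
  rw [dominoOp_smul]
  by_cases h : s = r + 1
  · subst h
    rw [y_lo_psi_ne hres (by omega) (by omega) (by simp [swapRes, add_assoc]),
      hx.y_three_two h1 hn, smul_neg, hx.braid_left h1 hn he, neg_zero]
  by_cases h' : s = r + 2
  · subst h'
    rw [y_hi_psi_ne hres (by omega) (by omega) (by simp [swapRes, add_assoc]),
      hx.y_three_one h1 hn, hx.braid_right h1 hn he]
  rw [yN_smul_psiN_comm (by omega) (by omega)]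
  by_cases h0 : s = r
  · rw [h0, hx.y_three_zero h1 hn, smul_neg, hx.braid_right h1 hn he, neg_zero]
  by_cases h3 : s = r + 3
  · rw [h3, hx.y_three_three h1 hn, hx.braid_left h1 hn he]
  rw [hx.y_three_of_lt_or_lt h1 hn (by omega), smul_zero]

theorem IsDomino.psi_dominoOp (hx : IsDomino F n x) (h1 : 1 ≤ r) (hn : r + 3 ≤ n) (he : Even r)
    {s : ℕ} (hs : Even s) : ψ s • E r • x = 0 := by
  by_cases h : s = r
  · rw [h, dominoOp_smul, braid_eq ((hx.res.psi (r + 1)).psi (r + 2)) h1 (by omega)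
      (Or.inl (by simp [swapRes, add_assoc])), hx.braid_right h1 hn he, smul_zero, smul_zero]
  by_cases h' : s = r + 2
  · rw [h', dominoOp_smul, psiN_smul_comm (s := r) (r := r + 2) (by omega) (by omega),
      ← braid_eq ((hx.res.psi (r + 1)).psi r) (r := r + 1) (by omega) (by omega)
      (Or.inr (by simp [swapRes, add_assoc])), hx.braid_left h1 hn he, smul_zero, smul_zero]
  obtain ⟨k, rfl⟩ := he
  obtain ⟨l, rfl⟩ := hs
  rw [psiN_smul_dominoOp_comm (by omega), hx.psi_smul _ ⟨l, rfl⟩, smul_zero]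

/-- The domino operators preserve the domino vectors. -/
theorem IsDomino.dominoOp (hx : IsDomino F n x) (h1 : 1 ≤ r) (hn : r + 3 ≤ n) (he : Even r) :
    IsDomino F n (E r • x) where
  res := by
    rw [dominoOp_smul]
    refine ((((hx.res.psi (r + 1)).psi (r + 2)).psi r).psi (r + 1)).congr fun p _ _ => ?_
    by_cases h0 : p = r
    · simp [swapRes, add_assoc, h0]
    by_cases h1 : p = r + 1
    · simp [swapRes, add_assoc, h1]
    by_cases h2 : p = r + 2
    · simp [swapRes, add_assoc, h2]
    by_cases h3 : p = r + 3
    · simp [swapRes, add_assoc, h3]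
    simp [swapRes, add_assoc, h0, h1, h2, h3]
  y_smul := hx.y_dominoOp h1 hn he
  psi_smul _ := hx.psi_dominoOp h1 hn he

/-- The analogue of the Temperley–Lieb relation `e² = -2 e`. -/
theorem IsDomino.psi_dominoOp_self (hx : IsDomino F n x) (h1 : 1 ≤ r) (hn : r + 3 ≤ n) :
    ψ (r + 1) • E r • x = -((2 : ℤ) • ψ (r + 1) • x) := by
  -- `ψ_{r+1}²` acts as `-(y_{r+1} - y_{r+2})²`, of which only the mixed terms
  -- `2 y_{r+1} y_{r+2}` survive
  rw [dominoOp_smul, psi_psi_ne (((hx.res.psi (r + 1)).psi (r + 2)).psi r) (by omega) (by omega)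
    (by simp [swapRes, add_assoc])]
  simp only [sub_smul, smul_sub, hx.y_three_one h1 hn, hx.y_three_two h1 hn, smul_neg,
    hx.y_psi_left_hi h1 hn, hx.y_psi_right_lo h1 hn,
    hx.y_psi_left_of_ne (s := r + 2) h1 hn (by omega) (by omega),
    hx.y_psi_right_of_ne (s := r + 1) h1 hn (by omega) (by omega)]
  rw [two_smul]
  abel

end Four

/-! ### Relations of Temperley–Lieb type for adjacent domino operators -/

section Six

variable {x : M} {r : ℕ}

/-- The analogue of the Temperley–Lieb relation `e_k e_{k+1} e_k = e_k`; it needs that `x` is killed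
by `ψ_{r+3}`. -/
theorem IsDomino.psi_dominoOp_dominoOp_up (hx : IsDomino F n x) (h1 : 1 ≤ r) (hn : r + 5 ≤ n)
    (he : Even r) (h : ψ (r + 3) • x = 0) : ψ (r + 1) • E (r + 2) • E r • x = ψ (r + 1) • x := by
  have hn' : r + 3 ≤ n := by omega
  have h31 : ψ (r + 3) • ψ (r + 1) • x = 0 := by
    rw [psiN_smul_comm (by omega) (by omega), h, smul_zero]
  have hx4 : ψ (r + 4) • x = 0 := hx.psi_smul _ (by simpa [parity_simps] using he)
  have h42 : ψ (r + 4) • ψ (r + 2) • ψ (r + 1) • x = 0 := by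
    rw [psiN_smul_comm (by omega) (by omega),
      psiN_smul_comm (s := r + 4) (r := r + 1) (by omega) (by omega), hx4, smul_zero, smul_zero]
  have hres3 := ((hx.res.psi (r + 1)).psi (r + 2)).psi r
  -- the vector to which the braid relation at `r + 1` is applied
  have hb := braid_ne ((hres3.psi (r + 3)).psi (r + 4)) (r := r + 1) (by omega) (by omega)
    (by simp [swapRes, add_assoc]) (by simp [swapRes, add_assoc])
  have e1 : ψ (r + 2) • ψ (r + 4) • ψ (r + 3) • ψ r • ψ (r + 2) • ψ (r + 1) • x = 0 := by
    rw [psiN_smul_comm (by omega) (by omega),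
      psiN_smul_comm (s := r + 3) (r := r) (by omega) (by omega),
      psiN_smul_comm (s := r + 2) (r := r) (by omega) (by omega),
      braid_eq (r := r + 2) (hx.res.psi (r + 1)) (by omega) (by omega)
        (Or.inl (by simp [swapRes, add_assoc])), h31]
    simp
  have e2 : y (r + 1) • ψ (r + 4) • ψ (r + 3) • ψ r • ψ (r + 2) • ψ (r + 1) • x
      = ψ (r + 4) • ψ (r + 3) • ψ (r + 2) • ψ (r + 1) • x := by
    rw [yN_smul_psiN_comm (by omega) (by omega), yN_smul_psiN_comm (by omega) (by omega),
      hx.y_three_one h1 hn']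
  have e3 : y (r + 2) • ψ (r + 4) • ψ (r + 3) • ψ r • ψ (r + 2) • ψ (r + 1) • x = 0 := by
    rw [yN_smul_psiN_comm (by omega) (by omega), yN_smul_psiN_comm (by omega) (by omega),
      hx.y_three_two h1 hn', smul_neg, psiN_smul_comm (by omega) (by omega), h31]
    simp
  have e4 : y (r + 3) • ψ (r + 4) • ψ (r + 3) • ψ r • ψ (r + 2) • ψ (r + 1) • x = 0 := by
    rw [yN_smul_psiN_comm (by omega) (by omega),
      y_lo_psi_ne hres3 (by omega) (by omega) (by simp [swapRes, add_assoc]),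
      hx.y_three_of_lt_or_lt h1 hn' (by omega)]
    simp
  have hb' := braid_ne ((hx.res.psi (r + 1)).psi (r + 2)) (r := r + 3) (by omega) (by omega)
    (by simp [swapRes, add_assoc]) (by simp [swapRes, add_assoc])
  rw [h42, hx.y_psi_right_hi h1 hn', hx.y_psi_right_of_ne h1 hn' (by omega) (by omega),
    hx.y_psi_right_of_ne h1 hn' (by omega) (by omega)] at hb'
  rw [e1, e2, e3, e4] at hb
  rw [dominoOp_smul (r + 2), dominoOp_smul r,
    psiN_smul_comm (s := r + 2 + 1) (r := r + 1) (by omega) (by omega),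
    psiN_smul_comm (s := r + 2 + 2) (r := r + 1) (by omega) (by omega),
    psiN_smul_comm (s := r + 1) (r := r + 2 + 1) (by omega) (by omega), hb]
  simpa using hb'

/-- The analogue of the Temperley–Lieb relation `e_{k+1} e_k e_{k+1} = e_{k+1}`; it needs that `x`
is killed by `ψ_{r+1}`. -/
theorem IsDomino.psi_dominoOp_dominoOp_down (hx : IsDomino F n x) (h1 : 1 ≤ r) (hn : r + 5 ≤ n)
    (he : Even r) (h : ψ (r + 1) • x = 0) : ψ (r + 3) • E r • E (r + 2) • x = ψ (r + 3) • x := by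
  have h1' : 1 ≤ r + 2 := by omega
  have hn' : r + 2 + 3 ≤ n := by omega
  have h13 : ψ (r + 1) • ψ (r + 3) • x = 0 := by
    rw [psiN_smul_comm (by omega) (by omega), h, smul_zero]
  have h02 : ψ r • ψ (r + 2) • ψ (r + 3) • x = 0 := by
    rw [psiN_smul_comm (by omega) (by omega),
      psiN_smul_comm (s := r) (r := r + 3) (by omega) (by omega), hx.psi_smul r he, smul_zero,
      smul_zero]
  have hres3 := ((hx.res.psi (r + 3)).psi (r + 4)).psi (r + 2)
  -- the vector to which the braid relation at `r + 2` is applied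
  have hb := braid_ne ((hres3.psi (r + 1)).psi r) (r := r + 2) (by omega) (by omega)
    (by simp [swapRes, add_assoc]) (by simp [swapRes, add_assoc])
  have e1 : ψ (r + 2) • ψ r • ψ (r + 1) • ψ (r + 2) • ψ (r + 4) • ψ (r + 3) • x = 0 := by
    rw [psiN_smul_comm (by omega) (by omega),
      psiN_smul_comm (s := r + 2) (r := r + 4) (by omega) (by omega),
      psiN_smul_comm (s := r + 1) (r := r + 4) (by omega) (by omega),
      psiN_smul_comm (s := r + 2) (r := r + 4) (by omega) (by omega),
      ← braid_eq (r := r + 1) (hx.res.psi (r + 3)) (by omega) (by omega)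
        (Or.inr (by simp [swapRes, add_assoc])), h13]
    simp
  have e2 : y (r + 2) • ψ r • ψ (r + 1) • ψ (r + 2) • ψ (r + 4) • ψ (r + 3) • x = 0 := by
    rw [yN_smul_psiN_comm (by omega) (by omega),
      y_hi_psi_ne hres3 (by omega) (by omega) (by simp [swapRes, add_assoc]),
      hx.y_three_of_lt_or_lt h1' hn' (by omega)]
    simp
  have e3 : y (r + 3) • ψ r • ψ (r + 1) • ψ (r + 2) • ψ (r + 4) • ψ (r + 3) • x = 0 := by
    rw [yN_smul_psiN_comm (by omega) (by omega), yN_smul_psiN_comm (by omega) (by omega),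
      hx.y_three_one h1' hn', psiN_smul_comm (s := r + 1) (by omega) (by omega), h13]
    simp
  have e4 : y (r + 4) • ψ r • ψ (r + 1) • ψ (r + 2) • ψ (r + 4) • ψ (r + 3) • x
      = -(ψ r • ψ (r + 1) • ψ (r + 2) • ψ (r + 3) • x) := by
    rw [yN_smul_psiN_comm (by omega) (by omega), yN_smul_psiN_comm (by omega) (by omega),
      hx.y_three_two h1' hn', smul_neg, smul_neg]
  have hb' := braid_ne ((hx.res.psi (r + 3)).psi (r + 2)) (r := r) (by omega) (by omega)
    (by simp [swapRes, add_assoc]) (by simp [swapRes, add_assoc])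
  rw [h02, hx.y_psi_left_lo h1' hn', hx.y_psi_left_of_ne h1' hn' (by omega) (by omega),
    hx.y_psi_left_of_ne h1' hn' (by omega) (by omega)] at hb'
  rw [e1, e2, e3, e4] at hb
  rw [dominoOp_smul r, dominoOp_smul (r + 2),
    psiN_smul_comm (s := r + 1) (r := r + 2 + 1) (by omega) (by omega),
    psiN_smul_comm (s := r) (r := r + 2) (by omega) (by omega),
    psiN_smul_comm (s := r) (r := r + 2 + 1) (by omega) (by omega),
    psiN_smul_comm (s := r + 3) (r := r + 1) (by omega) (by omega)]
  simp only [smul_zero, add_zero, sub_zero] at hb hb'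
  have hb2 := add_eq_zero_iff_eq_neg.1 hb.symm
  rw [hb2, neg_neg]
  exact (add_neg_eq_zero.1 hb'.symm)

end Six

end Algebra
/-! ### Independence of the reduced expression -/

section Shuffle

variable (F : Type*) [Field F] {n : ℕ} {M : Type*} [AddCommGroup M] [Module (KLR F n) M]

/-- `IsShuffle F m z w x` says that `w` is a permutation which can be written as a product of basic
transpositions, each of which moves a letter with preimage at most `m` upwards past a letter with
preimage larger than `m`, and that `x` is the result of applying the corresponding word in the `ψ_r`
to `z`. -/
inductive IsShuffle (m : ℕ) (z : M) : Equiv.Perm (Pos n) → M → Prop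
  | one : IsShuffle m z 1 z
  | step {w : Equiv.Perm (Pos n)} {x : M} (r : Idx n) (h : IsShuffle m z w x)
      (hlo : (w⁻¹ (lo r) : ℕ) ≤ m) (hhi : m < (w⁻¹ (hi r) : ℕ)) :
      IsShuffle m z (basicTransposition r * w) (psiElt F r • x)

theorem basicTransposition_mul_self (r : Idx n) :
    basicTransposition r * basicTransposition r = 1 := Equiv.swap_mul_self _ _

theorem basicTransposition_mul_inv_apply (r : Idx n) (w : Equiv.Perm (Pos n)) (p : Pos n) :
    (basicTransposition r * w)⁻¹ p = w⁻¹ (basicTransposition r p) := by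
  simp [mul_inv_rev, basicTransposition]

theorem basicTransposition_lo (r : Idx n) : basicTransposition r (lo r) = hi r :=
  Equiv.swap_apply_left _ _

theorem basicTransposition_hi (r : Idx n) : basicTransposition r (hi r) = lo r :=
  Equiv.swap_apply_right _ _

theorem basicTransposition_of_ne {r : Idx n} {p : Pos n} (h : (p : ℕ) ≠ r) (h' : (p : ℕ) ≠ r + 1) :
    basicTransposition r p = p :=
  Equiv.swap_apply_of_ne_of_ne (fun e => h (congrArg Subtype.val e))
    (fun e => h' (congrArg Subtype.val e))

theorem coe_basicTransposition (r : Idx n) (p : Pos n) :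
    (basicTransposition r p : ℕ) = if (p : ℕ) = r then (r : ℕ) + 1 else
      if (p : ℕ) = r + 1 then (r : ℕ) else p := by
  simp only [basicTransposition, Equiv.swap_apply_def, Subtype.ext_iff, lo, hi]
  split_ifs <;> rfl

theorem basicTransposition_comm {r s : Idx n} (h : (s : ℕ) ≠ r + 1) (h' : (r : ℕ) ≠ s + 1) :
    basicTransposition s * basicTransposition r = basicTransposition r * basicTransposition s := by
  by_cases hrs : r = s
  · rw [hrs]
  have hne : (r : ℕ) ≠ s := fun e => hrs (Subtype.ext e)
  have h1 : basicTransposition s (lo r) = lo r :=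
    basicTransposition_of_ne hne h'
  have h2 : basicTransposition s (hi r) = hi r :=
    basicTransposition_of_ne (Ne.symm h) (fun e => hne (Nat.add_right_cancel e))
  conv_lhs => rw [basicTransposition.eq_1 r, Equiv.mul_swap_eq_swap_mul, h1, h2]
  rfl

theorem psiElt_smul_comm {r s : Idx n} (h : (s : ℕ) ≠ r + 1) (h' : (r : ℕ) ≠ s + 1) (x : M) :
    psiElt F s • psiElt F r • x = psiElt F r • psiElt F s • x := by
  have := psiN_smul_comm (F := F) (n := n) h h' x
  rwa [psiN_of_mem r.2, psiN_of_mem s.2] at this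

variable {F} {m : ℕ} {z x x' : M} {w : Equiv.Perm (Pos n)}

/-- The last step of a shuffle may be any step that its permutation admits: two different such steps
commute, since a letter cannot be moved up and be passed at the same time. -/
theorem IsShuffle.exists_step (h : IsShuffle F m z w x) (s : Idx n)
    (hlo : m < (w⁻¹ (lo s) : ℕ)) (hhi : (w⁻¹ (hi s) : ℕ) ≤ m) :
    ∃ x₀, IsShuffle F m z (basicTransposition s * w) x₀ ∧ x = psiElt F s • x₀ := by
  induction h with
  | one =>
    have h1 : m < (s : ℕ) := hlo
    have h2 : (s : ℕ) + 1 ≤ m := hhi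
    omega
  | step r h hrlo hrhi ih =>
    rename_i w₁ x₁
    rw [basicTransposition_mul_inv_apply] at hlo hhi
    by_cases hrs : r = s
    · subst hrs
      exact ⟨x₁, by rwa [← mul_assoc, basicTransposition_mul_self, one_mul], rfl⟩
    have hne : (s : ℕ) ≠ r := fun e => hrs (Subtype.ext e.symm)
    by_cases h1 : (s : ℕ) = r + 1
    · have : lo s = hi r := Subtype.ext h1
      rw [this, basicTransposition_hi] at hlo
      omega
    by_cases h2 : (r : ℕ) = s + 1
    · have : hi s = lo r := Subtype.ext h2.symm
      rw [this, basicTransposition_lo] at hhi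
      omega
    have elo : basicTransposition r (lo s) = lo s := basicTransposition_of_ne hne h1
    have ehi : basicTransposition r (hi s) = hi s :=
      basicTransposition_of_ne (Ne.symm h2) (fun e => hne (Nat.add_right_cancel e))
    rw [elo] at hlo
    rw [ehi] at hhi
    obtain ⟨x₀, hx₀, rfl⟩ := ih hlo hhi
    refine ⟨psiElt F r • x₀, ?_, psiElt_smul_comm F h2 h1 _⟩
    rw [← mul_assoc, basicTransposition_comm h1 h2, mul_assoc]
    refine hx₀.step r ?_ ?_
    · rwa [basicTransposition_mul_inv_apply, basicTransposition_of_ne (Ne.symm hne) h2]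
    · rwa [basicTransposition_mul_inv_apply, basicTransposition_of_ne (Ne.symm h1)
        (fun e => hne (Nat.add_right_cancel e).symm)]

theorem IsShuffle.eq_of_eq_one (h : IsShuffle F m z w x) (hw : w = 1) : x = z := by
  cases h with
  | one => rfl
  | step r h hlo hhi =>
    rename_i w₁ x₁
    have : w₁ = basicTransposition r := by
      rw [← one_mul w₁, ← basicTransposition_mul_self r, mul_assoc, hw, mul_one]
    rw [this] at hlo hhi
    have h1 : (r : ℕ) + 1 ≤ m := by
      simpa [basicTransposition, hi] using hlo
    have h2 : m < (r : ℕ) := by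
      simpa [basicTransposition, lo] using hhi
    omega

theorem IsShuffle.unique (h : IsShuffle F m z w x) (h' : IsShuffle F m z w x') : x = x' := by
  induction h generalizing x' with
  | one => exact (h'.eq_of_eq_one rfl).symm
  | step r h hlo hhi ih =>
    obtain ⟨x₀, hx₀, rfl⟩ := h'.exists_step r
      (by rwa [basicTransposition_mul_inv_apply, basicTransposition_lo])
      (by rwa [basicTransposition_mul_inv_apply, basicTransposition_hi])
    rw [← mul_assoc, basicTransposition_mul_self, one_mul] at hx₀
    rw [ih hx₀]

/-- The sum of the images under `w` of the positions `1, …, m`. A basic transposition increases it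
by at most `1`. -/
def headSum (m : ℕ) (w : Equiv.Perm (Pos n)) : ℤ :=
  ∑ p ∈ Finset.univ.filter fun p : Pos n => (p : ℕ) ≤ m, ((w p : ℕ) : ℤ)

theorem headSum_mul (r : Idx n) (w : Equiv.Perm (Pos n)) :
    headSum m (basicTransposition r * w) = headSum m w
      + (if (w⁻¹ (lo r) : ℕ) ≤ m then 1 else 0) - (if (w⁻¹ (hi r) : ℕ) ≤ m then 1 else 0) := by
  have key : ∀ p : Pos n, (((basicTransposition r * w) p : ℕ) : ℤ)
      = ((w p : ℕ) : ℤ) + (if w⁻¹ (lo r) = p then 1 else 0)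
        - (if w⁻¹ (hi r) = p then 1 else 0) := by
    intro p
    rw [Equiv.Perm.mul_apply]
    have e1 : w⁻¹ (lo r) = p ↔ w p = lo r := by
      rw [Equiv.Perm.inv_eq_iff_eq, eq_comm]
    have e2 : w⁻¹ (hi r) = p ↔ w p = hi r := by
      rw [Equiv.Perm.inv_eq_iff_eq, eq_comm]
    have hne : lo r ≠ hi r := fun e => Nat.succ_ne_self _ (congrArg Subtype.val e).symm
    rw [if_congr e1 rfl rfl, if_congr e2 rfl rfl]
    by_cases h1 : w p = lo r
    · rw [h1, basicTransposition_lo, if_pos rfl, if_neg hne]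
      simp [lo, hi]
    by_cases h2 : w p = hi r
    · rw [h2, basicTransposition_hi, if_pos rfl, if_neg hne.symm]
      simp [lo, hi]
    rw [if_neg h1, if_neg h2, basicTransposition_of_ne (fun e => h1 (Subtype.ext e))
      (fun e => h2 (Subtype.ext e))]
    simp
  unfold headSum
  rw [Finset.sum_congr rfl fun p _ => key p, Finset.sum_sub_distrib, Finset.sum_add_distrib,
    Finset.sum_ite_eq, Finset.sum_ite_eq]
  simp only [Finset.mem_filter, Finset.mem_univ, true_and]

theorem headSum_prod_le (l : List (Idx n)) :
    headSum m (l.map basicTransposition).prod ≤ headSum m (1 : Equiv.Perm (Pos n)) + l.length := by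
  induction l with
  | nil => simp
  | cons r l ih =>
    rw [List.map_cons, List.prod_cons, headSum_mul, List.length_cons]
    push_cast
    split_ifs <;> omega

/-- A word which increases the head sum as fast as possible is a shuffle. -/
theorem isShuffle_of_headSum (l : List (Idx n))
    (h : headSum m (1 : Equiv.Perm (Pos n)) + l.length
      ≤ headSum m (l.map basicTransposition).prod) :
    IsShuffle F m z (l.map basicTransposition).prod (psiWord F l • z) := by
  induction l with
  | nil => simpa [psiWord] using IsShuffle.one
  | cons r l ih =>
    have hle := headSum_prod_le (m := m) l
    rw [List.map_cons, List.prod_cons, headSum_mul, List.length_cons] at h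
    push_cast at h
    rw [List.map_cons, List.prod_cons, psiWord, List.map_cons, List.prod_cons, mul_smul]
    have hlo : ((l.map basicTransposition).prod⁻¹ (lo r) : ℕ) ≤ m := by
      by_contra hc
      rw [if_neg hc] at h
      split_ifs at h <;> omega
    have hhi : ¬ ((l.map basicTransposition).prod⁻¹ (hi r) : ℕ) ≤ m := by
      intro hc
      rw [if_pos hc] at h
      split_ifs at h
      omega
    rw [if_pos hlo, if_neg hhi] at h
    exact (ih (by omega)).step r hlo (not_le.1 hhi)

theorem IsShuffle.exists_word (h : IsShuffle F m z w x) :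
    ∃ l : List (Idx n), (l.map basicTransposition).prod = w ∧
      headSum m (1 : Equiv.Perm (Pos n)) + l.length = headSum m w := by
  induction h with
  | one => exact ⟨[], rfl, by simp⟩
  | step r h hlo hhi ih =>
    obtain ⟨l, rfl, hl⟩ := ih
    refine ⟨r :: l, by simp, ?_⟩
    rw [headSum_mul, if_pos hlo, if_neg (not_le.2 hhi), List.length_cons]
    push_cast
    omega

/-- The vector of a shuffle can be computed from any reduced expression of its permutation. -/
theorem IsShuffle.psiWord_smul (h : IsShuffle F m z w x) {l : List (Idx n)}
    (hl : IsReducedExpression w l) : psiWord F l • z = x := by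
  obtain ⟨l', hl', hlen⟩ := h.exists_word
  obtain ⟨rfl, hmin⟩ := hl
  have := hmin l' hl'
  exact (isShuffle_of_headSum l (by omega)).unique h

theorem IsShuffle.step_of_apply_eq (h : IsShuffle F m z w x) (r : Idx n) {p q : Pos n}
    (hp : w p = lo r) (hq : w q = hi r) (hpm : (p : ℕ) ≤ m) (hqm : m < (q : ℕ)) :
    IsShuffle F m z (basicTransposition r * w) (psiElt F r • x) := by
  refine h.step r ?_ ?_
  · rwa [Equiv.Perm.inv_eq_iff_eq.2 hp.symm]
  · rwa [Equiv.Perm.inv_eq_iff_eq.2 hq.symm]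

/-- The involution of `ℕ` interchanging the dominoes `[r, r + 1]` and `[r + 2, r + 3]`. -/
def dominoSwap (r p : ℕ) : ℕ :=
  if p = r ∨ p = r + 1 then p + 2 else if p = r + 2 ∨ p = r + 3 then p - 2 else p

/-- A domino operator extends a shuffle by moving a domino up past the next one. -/
theorem IsShuffle.dominoOp (h : IsShuffle F m z w x) {r : ℕ} (hr : 1 ≤ r) (hn : r + 3 ≤ n)
    {w' : Equiv.Perm (Pos n)} (hw' : ∀ p, (w' p : ℕ) = dominoSwap r (w p)) {p₀ p₁ p₂ p₃ : Pos n}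
    (hp₀ : (w p₀ : ℕ) = r) (hp₁ : (w p₁ : ℕ) = r + 1) (hp₂ : (w p₂ : ℕ) = r + 2)
    (hp₃ : (w p₃ : ℕ) = r + 3) (h0 : (p₀ : ℕ) ≤ m) (h1 : (p₁ : ℕ) ≤ m)
    (h2 : m < (p₂ : ℕ)) (h3 : m < (p₃ : ℕ)) : IsShuffle F m z w' (dominoOp F n r • x) := by
  let r0 : Idx n := ⟨r, hr, by omega⟩
  let r1 : Idx n := ⟨r + 1, by omega, by omega⟩
  let r2 : Idx n := ⟨r + 2, by omega, by omega⟩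
  have e : w' = basicTransposition r1 * (basicTransposition r0 *
      (basicTransposition r2 * (basicTransposition r1 * w))) := by
    ext q
    simp only [hw', Equiv.Perm.mul_apply, dominoSwap, coe_basicTransposition, r0, r1, r2]
    generalize (w q : ℕ) = t
    clear * -
    grind
  have s1 := h.step_of_apply_eq r1 (p := p₁) (q := p₂) (Subtype.ext hp₁) (Subtype.ext hp₂) h1 h2
  have s2 := s1.step_of_apply_eq r2 (p := p₁) (q := p₃)
    (Subtype.ext (by simp [coe_basicTransposition, hp₁, lo, r1, r2, add_assoc]))
    (Subtype.ext (by simp [coe_basicTransposition, hp₃, hi, r1, r2, add_assoc])) h1 h3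
  have s3 := s2.step_of_apply_eq r0 (p := p₀) (q := p₂)
    (Subtype.ext (by simp [coe_basicTransposition, hp₀, lo, r0, r1, r2, add_assoc]))
    (Subtype.ext (by simp [coe_basicTransposition, hp₂, hi, r0, r1, r2, add_assoc])) h0 h2
  have s4 := s3.step_of_apply_eq r1 (p := p₀) (q := p₃)
    (Subtype.ext (by simp [coe_basicTransposition, hp₀, lo, r0, r1, r2, add_assoc]))
    (Subtype.ext (by simp [coe_basicTransposition, hp₃, hi, r0, r1, r2, add_assoc])) h0 h3
  rw [e, dominoOp_smul, psiN_of_mem r0.2, psiN_of_mem r1.2, psiN_of_mem r2.2]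
  exact s4

end Shuffle

/-! ### The vectors of the domino tableaux and the vanishing of their weighted sum -/

section Sums

variable (F : Type*) [Field F] (n : ℕ) {M : Type*} [AddCommGroup M] [Module (KLR F n) M]

local notation "ψ" => psiN F n
local notation "E" => dominoOp F n

/-- The vector obtained from `z` by moving the domino number `B` up to the place number `B + m + 1`,
and then moving the dominoes number `B - 1, …, B - l` up by one place each. For the generator `z` of
the Specht module, it belongs to the domino tableau whose leg contains the dominoes number
`1, …, B` without the one number `B - l`, and the domino number `B + m + 1`. -/
def dominoVec (B : ℕ) (z : M) : ℕ → ℕ → M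
  | 0, 0 => E (2 * B) • z
  | 0, m + 1 => E (2 * (B + m + 1)) • dominoVec B z 0 m
  | l + 1, m => E (2 * (B - (l + 1))) • dominoVec B z l m

/-- The sum of the vectors `dominoVec F n B z l m`, weighted by `(B - l) (N - B - m)`. -/
def weightedSum (N B : ℕ) (z : M) : M :=
  ∑ l ∈ Finset.range B, ∑ m ∈ Finset.range (N - B),
    ((B - l) * (N - B - m)) • dominoVec F n B z l m

variable {F n}

theorem IsDomino.nsmul {x : M} (hx : IsDomino F n x) (k : ℕ) : IsDomino F n (k • x) where
  res := by rw [HasRes, smul_comm, hx.res]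
  y_smul r := by rw [smul_comm, hx.y_smul, smul_zero]
  psi_smul r hr := by rw [smul_comm, hx.psi_smul r hr, smul_zero]

theorem IsDomino.sum {ι : Type*} {s : Finset ι} {f : ι → M} (h : ∀ i ∈ s, IsDomino F n (f i)) :
    IsDomino F n (∑ i ∈ s, f i) where
  res := by rw [HasRes, Finset.smul_sum]; exact Finset.sum_congr rfl fun i hi => (h i hi).res
  y_smul r := by rw [Finset.smul_sum]; exact Finset.sum_eq_zero fun i hi => (h i hi).y_smul r
  psi_smul r hr := by
    rw [Finset.smul_sum]; exact Finset.sum_eq_zero fun i hi => (h i hi).psi_smul r hr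

/-- A linear weight is orthogonal to the pattern `1, -2, 1`. The last entry of the pattern may fall
on the place `K`, where the weight vanishes. -/
theorem sum_linear_weight_eq_zero {K p : ℕ} (hp : p + 1 < K) {g : ℕ → M} {w : M} (h0 : g p = w)
    (h1 : g (p + 1) = -((2 : ℤ) • w)) (h2 : p + 2 < K → g (p + 2) = w)
    (h : ∀ m < K, m ≠ p → m ≠ p + 1 → m ≠ p + 2 → g m = 0) :
    ∑ m ∈ Finset.range K, (K - m) • g m = 0 := by
  have key : ∀ m ∈ Finset.range (K + 1), (K - m) • g m
      = (if m = p then ((K : ℤ) - p) • w else 0)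
        + (if m = p + 1 then -(2 * ((K : ℤ) - p - 1)) • w else 0)
        + (if m = p + 2 then ((K : ℤ) - p - 2) • w else 0) := by
    intro m hm
    have hm' : m ≤ K := by simpa [Nat.lt_succ_iff] using hm
    rw [← natCast_zsmul, Nat.cast_sub hm']
    by_cases c0 : m = p
    · simp [c0, h0]
    by_cases c1 : m = p + 1
    · rw [c1, h1, if_neg (by omega), if_pos rfl, if_neg (by omega), zero_add, add_zero, ← neg_smul,
        smul_smul]
      congr 1
      push_cast
      ring
    by_cases c2 : m = p + 2
    · rw [c2, if_neg (by omega), if_neg (by omega), if_pos rfl, zero_add, zero_add]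
      rcases Nat.lt_or_ge (p + 2) K with hK | hK
      · rw [h2 hK]
        congr 1
        push_cast
        ring
      · have e : ((K : ℤ) - ((p + 2 : ℕ) : ℤ)) = 0 := by omega
        have e' : (K : ℤ) - p - 2 = 0 := by omega
        rw [e, e', zero_smul, zero_smul]
    rw [if_neg c0, if_neg c1, if_neg c2, add_zero, add_zero]
    rcases Nat.lt_or_ge m K with hK | hK
    · rw [h m hK c0 c1 c2, smul_zero]
    · rw [show (K : ℤ) - m = 0 by omega, zero_smul]
  have hsum : ∑ m ∈ Finset.range (K + 1), (K - m) • g m = 0 := by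
    rw [Finset.sum_congr rfl key, Finset.sum_add_distrib, Finset.sum_add_distrib,
      Finset.sum_ite_eq', Finset.sum_ite_eq', Finset.sum_ite_eq',
      if_pos (Finset.mem_range.2 (by omega)), if_pos (Finset.mem_range.2 (by omega)),
      if_pos (Finset.mem_range.2 (by omega)), ← add_smul, ← add_smul]
    convert zero_smul ℤ w using 2
    ring
  rwa [Finset.sum_range_succ, Nat.sub_self, zero_smul, add_zero] at hsum

section

variable {B : ℕ} {z : M}

theorem dominoVec_succ_left (l m : ℕ) :
    dominoVec F n B z (l + 1) m = E (2 * (B - (l + 1))) • dominoVec F n B z l m := by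
  rw [dominoVec]

theorem dominoVec_succ_right (hB : 1 ≤ B) (l m : ℕ) :
    dominoVec F n B z l (m + 1) = E (2 * (B + m + 1)) • dominoVec F n B z l m := by
  induction l with
  | zero => rw [dominoVec]
  | succ l ih =>
    rw [dominoVec_succ_left, ih, dominoVec_succ_left]
    exact (dominoOp_smul_comm (by omega) _).symm

theorem psi_dominoVec_of_lt (hz : ∀ r, r ≠ 2 * B + 1 → ψ r • z = 0) {k l m : ℕ}
    (hk : k + l + 1 < B) : ψ (2 * k + 1) • dominoVec F n B z l m = 0 := by
  induction l with
  | zero =>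
    induction m with
    | zero =>
      rw [dominoVec, psiN_smul_dominoOp_comm (by omega), hz _ (by omega), smul_zero]
    | succ m ih => rw [dominoVec, psiN_smul_dominoOp_comm (by omega), ih, smul_zero]
  | succ l ih =>
    rw [dominoVec, psiN_smul_dominoOp_comm (by omega), ih (by omega), smul_zero]

theorem psi_dominoVec_of_gt (hz : ∀ r, r ≠ 2 * B + 1 → ψ r • z = 0) {k l m : ℕ}
    (hk : B + m + 2 ≤ k) : ψ (2 * k + 1) • dominoVec F n B z l m = 0 := by
  induction l with
  | zero =>
    induction m with
    | zero =>
      rw [dominoVec, psiN_smul_dominoOp_comm (by omega), hz _ (by omega), smul_zero]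
    | succ m ih =>
      rw [dominoVec, psiN_smul_dominoOp_comm (by omega), ih (by omega), smul_zero]
  | succ l ih =>
    rw [dominoVec, psiN_smul_dominoOp_comm (by omega), ih, smul_zero]

end

end Sums

section Weighted

variable {F : Type*} [Field F] {N B : ℕ} {M : Type*} [AddCommGroup M]
  [Module (KLR F (2 * N + 1)) M] {z : M}

local notation "ψ" => psiN F (2 * N + 1)
local notation "E" => dominoOp F (2 * N + 1)
local notation "dVec" => dominoVec F (2 * N + 1) B z

theorem isDomino_dominoVec (hz : IsDomino F (2 * N + 1) z) {l m : ℕ} (hl : l < B)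
    (hm : B + m < N) : IsDomino F (2 * N + 1) (dVec l m) := by
  induction l with
  | zero =>
    induction m with
    | zero => rw [dominoVec]; exact hz.dominoOp (by omega) (by omega) (even_two_mul _)
    | succ m ih =>
      rw [dominoVec]
      exact (ih (by omega)).dominoOp (by omega) (by omega) (even_two_mul _)
  | succ l ih =>
    rw [dominoVec]
    exact (ih (by omega)).dominoOp (by omega) (by omega) (even_two_mul _)

theorem dominoOp_smul_eq_zero {r : ℕ} {x : M} (h : ψ (r + 1) • x = 0) : E r • x = 0 := by
  rw [dominoOp_smul, h]
  simp

section Left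

variable {p k m : ℕ}

/-! Fix `k < B` and write `p = B - k - 1`, so that `dominoVec p m` belongs to the tableau in which
the domino number `k + 1` has been removed from the leg. The values of `ψ_{2k+1}` on the vectors
`dominoVec l m` are `1, -2, 1` times the same vector for `l = p, p + 1, p + 2`, and `0` for all
other `l`. -/

theorem psi_dominoVec_left_one (hz : IsDomino F (2 * N + 1) z) (hk : 1 ≤ k) (hB : p + 1 + k = B)
    (hm : B + m < N) : ψ (2 * k + 1) • dVec (p + 1) m = -((2 : ℤ) • ψ (2 * k + 1) • dVec p m) := by
  rw [dominoVec_succ_left, show B - (p + 1) = k by omega]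
  exact (isDomino_dominoVec (l := p) hz (by omega) hm).psi_dominoOp_self (by omega) (by omega)

theorem psi_dominoVec_left_two (hz : IsDomino F (2 * N + 1) z)
    (hz' : ∀ r, r ≠ 2 * B + 1 → ψ r • z = 0) (hk : 2 ≤ k) (hB : p + 1 + k = B)
    (hm : B + m < N) : ψ (2 * k + 1) • dVec (p + 2) m = ψ (2 * k + 1) • dVec p m := by
  obtain ⟨k, rfl⟩ := Nat.exists_eq_add_of_le' hk
  rw [dominoVec_succ_left, dominoVec_succ_left, show B - (p + 1 + 1) = k + 1 by omega,
    show B - (p + 1) = k + 2 by omega]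
  exact (isDomino_dominoVec (l := p) hz (by omega) hm).psi_dominoOp_dominoOp_down (r := 2 * (k + 1))
    (by omega) (by omega) (even_two_mul _) (psi_dominoVec_of_lt hz' (by omega))

theorem psi_dominoVec_left_far (hz : IsDomino F (2 * N + 1) z)
    (hz' : ∀ r, r ≠ 2 * B + 1 → ψ r • z = 0) (hB : p + 1 + k = B)
    (hm : B + m < N) {t : ℕ} (ht : p + 3 + t < B) : ψ (2 * k + 1) • dVec (p + 3 + t) m = 0 := by
  induction t with
  | zero =>
    rw [add_zero, dominoVec_succ_left, psiN_smul_dominoOp_comm (by omega),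
      psi_dominoVec_left_two hz hz' (by omega) hB hm, ← psiN_smul_dominoOp_comm (by omega),
      dominoOp_smul_eq_zero (psi_dominoVec_of_lt hz' (by omega)), smul_zero]
  | succ t ih =>
    rw [← add_assoc, dominoVec_succ_left, psiN_smul_dominoOp_comm (by omega), ih (by omega),
      smul_zero]

end Left

section Right

variable {p k l : ℕ}

/-! The same pattern appears for `k > B` and `m = p, p + 1, p + 2`, where `p = k - B - 1`. -/

theorem psi_dominoVec_right_one (hz : IsDomino F (2 * N + 1) z) (hl : l < B)
    (hB : B + p + 1 = k) (hk : k < N) :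
    ψ (2 * k + 1) • dVec l (p + 1) = -((2 : ℤ) • ψ (2 * k + 1) • dVec l p) := by
  rw [dominoVec_succ_right (Nat.one_le_of_lt hl), hB]
  exact (isDomino_dominoVec (m := p) hz hl (by omega)).psi_dominoOp_self (by omega) (by omega)

theorem psi_dominoVec_right_two (hz : IsDomino F (2 * N + 1) z)
    (hz' : ∀ r, r ≠ 2 * B + 1 → ψ r • z = 0) (hl : l < B) (hB : B + p + 1 = k) (hk : k + 1 < N) :
    ψ (2 * k + 1) • dVec l (p + 2) = ψ (2 * k + 1) • dVec l p := by
  rw [dominoVec_succ_right (Nat.one_le_of_lt hl), dominoVec_succ_right (Nat.one_le_of_lt hl), hB,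
    show B + (p + 1) + 1 = k + 1 by omega]
  exact (isDomino_dominoVec (m := p) hz hl (by omega)).psi_dominoOp_dominoOp_up (r := 2 * k)
    (by omega) (by omega) (even_two_mul _) (psi_dominoVec_of_gt hz' (k := k + 1) (by omega))

theorem psi_dominoVec_right_far (hz : IsDomino F (2 * N + 1) z)
    (hz' : ∀ r, r ≠ 2 * B + 1 → ψ r • z = 0) (hl : l < B) (hB : B + p + 1 = k) (hk : k + 1 < N)
    (t : ℕ) : ψ (2 * k + 1) • dVec l (p + 3 + t) = 0 := by
  induction t with
  | zero =>
    rw [add_zero, dominoVec_succ_right (Nat.one_le_of_lt hl), psiN_smul_dominoOp_comm (by omega),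
      psi_dominoVec_right_two hz hz' hl hB hk, ← psiN_smul_dominoOp_comm (by omega),
      dominoOp_smul_eq_zero (psi_dominoVec_of_gt hz' (by omega)), smul_zero]
  | succ t ih =>
    rw [← add_assoc, dominoVec_succ_right (Nat.one_le_of_lt hl), psiN_smul_dominoOp_comm (by omega),
      ih, smul_zero]

end Right

theorem sum_left_eq_zero (hz : IsDomino F (2 * N + 1) z)
    (hz' : ∀ r, r ≠ 2 * B + 1 → ψ r • z = 0) {k m : ℕ} (hk : 1 ≤ k) (hkB : k < B)
    (hm : B + m < N) : ∑ l ∈ Finset.range B, (B - l) • ψ (2 * k + 1) • dVec l m = 0 := by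
  obtain ⟨p, rfl⟩ : ∃ p, p + 1 + k = B := ⟨B - k - 1, by omega⟩
  refine sum_linear_weight_eq_zero (p := p) (by omega) rfl
    (psi_dominoVec_left_one hz hk rfl hm)
    (fun h => psi_dominoVec_left_two hz hz' (by omega) rfl hm) fun l hl h0 h1 h2 => ?_
  rcases Nat.lt_or_ge l p with h | h
  · exact psi_dominoVec_of_lt hz' (by omega)
  · obtain ⟨t, rfl⟩ : ∃ t, l = p + 3 + t := ⟨l - (p + 3), by omega⟩
    exact psi_dominoVec_left_far hz hz' rfl hm hl

theorem sum_right_eq_zero (hz : IsDomino F (2 * N + 1) z)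
    (hz' : ∀ r, r ≠ 2 * B + 1 → ψ r • z = 0) {k l : ℕ} (hl : l < B) (hBk : B < k) (hk : k < N) :
    ∑ m ∈ Finset.range (N - B), (N - B - m) • ψ (2 * k + 1) • dVec l m = 0 := by
  obtain ⟨p, rfl⟩ : ∃ p, B + p + 1 = k := ⟨k - B - 1, by omega⟩
  refine sum_linear_weight_eq_zero (p := p) (by omega) rfl
    (psi_dominoVec_right_one hz hl rfl hk)
    (fun h => psi_dominoVec_right_two hz hz' hl rfl (by omega)) fun m hm h0 h1 h2 => ?_
  rcases Nat.lt_or_ge m p with h | h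
  · exact psi_dominoVec_of_gt hz' (by omega)
  · obtain ⟨t, rfl⟩ : ∃ t, m = p + 3 + t := ⟨m - (p + 3), by omega⟩
    exact psi_dominoVec_right_far hz hz' hl rfl (by omega) t

theorem isDomino_weightedSum (hz : IsDomino F (2 * N + 1) z) :
    IsDomino F (2 * N + 1) (weightedSum F (2 * N + 1) N B z) :=
  IsDomino.sum fun _ hl => IsDomino.sum fun m hm => (isDomino_dominoVec (m := m) hz
    (Finset.mem_range.1 hl) (by have := Finset.mem_range.1 hm; omega)).nsmul _

/-- For `k < B` the weights `B - l`, and for `k > B` the weights `N - B - m`, make the image of the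
sum vanish. -/
theorem psi_weightedSum (hz : IsDomino F (2 * N + 1) z)
    (hz' : ∀ r, r ≠ 2 * B + 1 → ψ r • z = 0) {k : ℕ} (hk : 1 ≤ k) (hkN : k < N) (hkB : k ≠ B) :
    ψ (2 * k + 1) • weightedSum F (2 * N + 1) N B z = 0 := by
  rw [weightedSum]
  rcases Nat.lt_or_gt_of_ne hkB with h | h
  · rw [Finset.sum_comm, Finset.smul_sum]
    refine Finset.sum_eq_zero fun m hm => ?_
    have key := sum_left_eq_zero hz hz' hk h (m := m) (by have := Finset.mem_range.1 hm; omega)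
    rw [Finset.smul_sum, ← smul_zero (N - B - m), ← key, Finset.smul_sum]
    refine Finset.sum_congr rfl fun l _ => ?_
    rw [smul_comm, mul_comm, mul_smul]
  · rw [Finset.smul_sum]
    refine Finset.sum_eq_zero fun l hl => ?_
    have key := sum_right_eq_zero hz hz' (Finset.mem_range.1 hl) h hkN
    rw [Finset.smul_sum, ← smul_zero (B - l), ← key, Finset.smul_sum]
    refine Finset.sum_congr rfl fun m _ => ?_
    rw [smul_comm, mul_smul]

end Weighted

/-! ### The domino tableaux -/

section Tableaux

variable {F : Type*} [Field F] {a b : ℕ} {M : Type*} [AddCommGroup M] [Module (KLR F (a + b)) M]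

/-- The permutation of the domino tableau `T_{i,j}`, written out: the positions `1, …, b + 1` are
those of the first column, and the position `b + c` is the one of the node `(1, c)`, if `c ≥ 2`. -/
theorem coe_tableauPerm_dominoTableau (ha : 0 < a) (x : oddPairs a b) {i j : ℕ} (hi : x.1.1 = i)
    (hj : x.1.2 = j) (p : Pos (a + b)) :
    (tableauPerm ha (dominoTableau x) p : ℕ)
      = if (p : ℕ) < i - 1 then (p : ℕ) else if (p : ℕ) < b then p + 2 else
        if (p : ℕ) = b then j - 1 else if (p : ℕ) = b + 1 then j else
        if (p : ℕ) = b + 2 then i - 1 else if (p : ℕ) = b + 3 then i else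
        if (p : ℕ) ≤ j then p - 2 else p := by
  have hx := mem_oddPairs.1 x.2
  have h : (tableauPerm ha (dominoTableau x) p : ℕ) = dominoEntry b x.1.1 x.1.2
    (if (p : ℕ) ≤ b + 1 then ((p : ℕ), 1) else (1, (p : ℕ) - b)) := rfl
  rw [hi, hj] at hx h
  rw [h]
  have hp := p.2
  generalize (p : ℕ) = p at *
  clear * - hx hp
  obtain ⟨⟨⟨h1, h2⟩, h3, h4⟩, -⟩ := hx
  obtain ⟨hp1, hp2⟩ := hp
  by_cases hp : p ≤ b + 1
  · rw [if_pos hp, dominoEntry, if_pos rfl]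
    split_ifs <;> omega
  · rw [if_neg hp, dominoEntry, if_neg (by simp only; omega)]
    split_ifs <;> omega

/-- The vectors `dominoVec F n B z l m` belong to the permutations of the domino tableaux. -/
theorem isShuffle_dominoTableau (ha : 0 < a) {A B : ℕ} (hA : a = 2 * A + 1) (hB : b = 2 * B)
    (z : M) {l m : ℕ} (hl : l < B) (hm : m < A) (x : oddPairs a b)
    (hx1 : x.1.1 = 2 * (B - l) + 1) (hx2 : x.1.2 = 2 * (B + m + 1) + 1) :
    IsShuffle F (b + 1) z (tableauPerm ha (dominoTableau x))
      (dominoVec F (a + b) B z l m) := by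
  induction l generalizing x with
  | zero =>
    induction m generalizing x with
    | zero =>
      rw [dominoVec]
      refine IsShuffle.one.dominoOp (by omega) (by omega) (fun p => ?_)
        (p₀ := ⟨b, by omega, by omega⟩) (p₁ := ⟨b + 1, by omega, by omega⟩)
        (p₂ := ⟨b + 2, by omega, by omega⟩) (p₃ := ⟨b + 3, by omega, by omega⟩)
        hB (congrArg (· + 1) hB) (congrArg (· + 2) hB) (congrArg (· + 3) hB)
        (Nat.le_succ b) le_rfl (Nat.lt_succ_self _) (Nat.lt_add_of_pos_right Nat.two_pos)
      rw [coe_tableauPerm_dominoTableau ha x hx1 hx2, Equiv.Perm.one_apply]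
      generalize (p : ℕ) = p
      clear * - hB hl
      unfold dominoSwap
      grind
    | succ m ih =>
      have hx : (2 * B + 1, 2 * (B + m + 1) + 1) ∈ oddPairs a b := by
        rw [mem_oddPairs]
        refine ⟨by simp only; omega, odd_two_mul_add_one _, odd_two_mul_add_one _⟩
      rw [dominoVec]
      refine (ih (by omega) ⟨_, hx⟩ rfl rfl).dominoOp (by omega) (by omega) (fun p => ?_)
        (p₀ := ⟨b, by omega, by omega⟩) (p₁ := ⟨b + 1, by omega, by omega⟩)
        (p₂ := ⟨2 * (B + m + 1) + 2, by omega, by omega⟩)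
        (p₃ := ⟨2 * (B + m + 1) + 3, by omega, by omega⟩) ?_ ?_ ?_ ?_
        (Nat.le_succ b) le_rfl (show b + 1 < 2 * (B + m + 1) + 2 by omega)
        (show b + 1 < 2 * (B + m + 1) + 3 by omega)
      · have hp := coe_tableauPerm_dominoTableau ha ⟨_, hx⟩ (i := 2 * B + 1)
          (j := 2 * (B + m + 1) + 1) rfl rfl p
        rw [coe_tableauPerm_dominoTableau ha x hx1 hx2]
        generalize (tableauPerm ha (dominoTableau ⟨_, hx⟩) p : ℕ) = q at hp ⊢
        generalize (p : ℕ) = p at hp ⊢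
        clear * - hB hl hp
        unfold dominoSwap
        split_ifs at hp <;> subst hp <;> split_ifs <;> omega
      all_goals
        rw [coe_tableauPerm_dominoTableau ha _ rfl rfl]
        clear * - hB hl
        grind
  | succ l ih =>
    have hx : (2 * (B - l) + 1, 2 * (B + m + 1) + 1) ∈ oddPairs a b := by
      rw [mem_oddPairs]
      refine ⟨by simp only; omega, odd_two_mul_add_one _, odd_two_mul_add_one _⟩
    rw [dominoVec]
    refine (ih (by omega) ⟨_, hx⟩ rfl rfl).dominoOp (by omega) (by omega) (fun p => ?_)
      (p₀ := ⟨2 * (B - (l + 1)), by omega, by omega⟩)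
      (p₁ := ⟨2 * (B - (l + 1)) + 1, by omega, by omega⟩)
      (p₂ := ⟨b + 2, by omega, by omega⟩) (p₃ := ⟨b + 3, by omega, by omega⟩) ?_ ?_ ?_ ?_
      (show 2 * (B - (l + 1)) ≤ b + 1 by omega) (show 2 * (B - (l + 1)) + 1 ≤ b + 1 by omega)
      (Nat.lt_succ_self _) (Nat.lt_add_of_pos_right Nat.two_pos)
    · have hp := coe_tableauPerm_dominoTableau ha ⟨_, hx⟩ (i := 2 * (B - l) + 1)
        (j := 2 * (B + m + 1) + 1) rfl rfl p
      rw [coe_tableauPerm_dominoTableau ha x hx1 hx2]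
      generalize (tableauPerm ha (dominoTableau ⟨_, hx⟩) p : ℕ) = q at hp ⊢
      generalize (p : ℕ) = p at hp ⊢
      clear * - hB hl hp
      unfold dominoSwap
      split_ifs at hp <;> subst hp <;> split_ifs <;> omega
    all_goals
      rw [coe_tableauPerm_dominoTableau ha _ rfl rfl]
      clear * - hB hl
      grind

end Tableaux

/-! ### The endomorphism of the Specht module -/

section Main

/-- A product `ψ_s ψ_{s+1} ⋯ ψ_{s+t-1}` moves the residue at the position `s + t` to the
position `s`. -/
theorem HasRes.psiWord {F : Type*} [Field F] {n : ℕ} {M : Type*} [AddCommGroup M]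
    [Module (KLR F n) M] {c : ℕ → ZMod 2} {x : M} (hx : HasRes F n c x) {t s : ℕ}
    (g : Fin t → Idx n) (hg : ∀ k, (g k : ℕ) = k + s) :
    ∃ c', HasRes F n c' (psiWord F (List.ofFn g) • x) ∧ c' s = c (s + t) := by
  induction t generalizing s with
  | zero => exact ⟨c, by simpa [HookSpecht.psiWord] using hx, rfl⟩
  | succ t ih =>
    obtain ⟨c', hc', he⟩ := ih (s := s + 1) (fun k => g k.succ)
      (fun k => by rw [hg, Fin.val_succ]; omega)
    refine ⟨swapRes (g 0) c', ?_, ?_⟩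
    · rw [List.ofFn_succ, HookSpecht.psiWord, List.map_cons, List.prod_cons, mul_smul]
      have := hc'.psi (g 0)
      rw [psiN_of_mem (g 0).2] at this
      exact this
    · have h0 : (g 0 : ℕ) = s := by simpa using hg 0
      rw [swapRes, if_pos h0.symm, h0, he]
      congr 1
      omega

variable (F : Type*) [Field F]

variable {a b : ℕ} (ha : 0 < a)

theorem smul_spechtGen_of_rel {h : KLR F (a + b)} (hh : SpechtRel F a b ha h) :
    h • spechtGen F a b ha = 0 := by
  rw [spechtGen, ← Submodule.Quotient.mk_smul, smul_eq_mul, mul_one,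
    Submodule.Quotient.mk_eq_zero]
  exact Submodule.subset_span hh

/-- As `b` is even, the residues alternate also where the first column ends. -/
theorem residueSequence_initialTableau {B : ℕ} (hB : b = 2 * B) :
    residueSequence (initialTableau a b ha) = fun p : Pos (a + b) => altRes p := by
  have h2 : (2 : ZMod 2) = 0 := rfl
  have hneg : (-1 : ZMod 2) = 1 := rfl
  funext p
  obtain ⟨p, hp1, hp2⟩ := p
  simp only [residueSequence, initialTableau, Equiv.coe_fn_symm_mk, altRes]
  split_ifs with h
  · simp only [Nat.cast_one]
    rw [sub_eq_add_neg, ZMod.neg_eq_self_mod_two, add_comm]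
  · simp only [Nat.cast_one]
    rw [Nat.cast_sub (by omega), hB, sub_eq_add_neg, hneg]
    simp [h2]

theorem isDomino_spechtGen {B : ℕ} (hB : b = 2 * B) :
    IsDomino F (a + b) (spechtGen F a b ha) where
  res := by
    have := smul_spechtGen_of_rel F ha (SpechtRel.e fun p : Pos (a + b) => altRes p)
    rw [if_pos (residueSequence_initialTableau ha hB).symm, sub_smul, one_smul, sub_eq_zero] at this
    exact this
  y_smul r := by
    by_cases h : r ∈ Set.Icc 1 (a + b)
    · rw [yN_of_mem h, smul_spechtGen_of_rel F ha (SpechtRel.y _)]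
    · simp [yN, h]
  psi_smul r hr := by
    by_cases h : r ∈ Set.Ico 1 (a + b)
    · rw [psiN_of_mem h, smul_spechtGen_of_rel F ha (SpechtRel.psi _ fun e => ?_)]
      rw [show r = b + 1 from e, hB] at hr
      simp [parity_simps] at hr
    · simp [psiN, h]

theorem psi_smul_spechtGen {r : ℕ} (hr : r ≠ b + 1) :
    psiN F (a + b) r • spechtGen F a b ha = 0 := by
  by_cases h : r ∈ Set.Ico 1 (a + b)
  · rw [psiN_of_mem h, smul_spechtGen_of_rel F ha (SpechtRel.psi _ hr)]
  · simp [psiN, h]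

variable {F} in
/-- A domino vector which is killed by the `ψ_r` with `r ≠ 1, b + 1` odd satisfies the relations of
the generator of the Specht module: `ψ_1` and the Garnir element map it to a vector whose residue
sequence starts with `1`. -/
theorem smul_eq_zero_of_rel {M : Type*} [AddCommGroup M] [Module (KLR F (a + b)) M] {B : ℕ}
    (hB : b = 2 * B) {u : M} (hu : IsDomino F (a + b) u)
    (hψ : ∀ k, 1 ≤ k → 2 * k + 1 < a + b → k ≠ B → psiN F (a + b) (2 * k + 1) • u = 0)
    {h : KLR F (a + b)} (hh : SpechtRel F a b ha h) : h • u = 0 := by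
  cases hh with
  | y k => rw [← hu.y_smul k, yN_of_mem k.2]
  | e i =>
    have hres : eElt F (fun p : Pos (a + b) => altRes p) • u = u := hu.res
    rw [residueSequence_initialTableau ha hB]
    split_ifs with hi
    · rw [hi, sub_smul, hres, one_smul, sub_self]
    · have := mkAlgHom_eq_of_rel (F := F) (KLRRel.e_orth i _ hi)
      rw [map_mul, map_zero] at this
      change eElt F i * eElt F _ = 0 at this
      rw [sub_zero, ← hres, ← mul_smul, this, zero_smul]
  | psi j hj =>
    rw [← psiN_of_mem j.2]
    rcases Nat.even_or_odd' (j : ℕ) with ⟨k, hk | hk⟩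
    · exact hu.psi_smul _ (hk ▸ even_two_mul k)
    · rcases Nat.eq_zero_or_pos k with rfl | hk0
      · exact (hu.res.psi j).eq_zero (by omega) (by rw [hk]; rfl)
      · have := j.2.2
        rw [hk]
        exact hψ k hk0 (by omega) (by omega)
  | garnir hab =>
    obtain ⟨c, hc, h1⟩ := hu.res.psiWord (s := 1) (fun k : Fin (b + 1) =>
      (⟨k.1 + 1, Nat.le_add_left 1 k.1, (Nat.succ_le_of_lt k.2).trans_lt hab⟩ : Idx (a + b)))
      (fun _ => rfl)
    refine hc.eq_zero (by omega) ?_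
    have h2 : (2 : ZMod 2) = 0 := rfl
    rw [h1, altRes, hB]
    push_cast
    rw [h2, zero_mul]
    rfl

/-- The sum over the domino tableaux, indexed by the numbers `B - l` and `B + m + 1` of the dominoes
removed from and added to the leg. -/
theorem sum_dominoTableau {A B : ℕ} (hA : a = 2 * A + 1) (hB : b = 2 * B)
    (pref : Equiv.Perm (Pos (a + b)) → List (Idx (a + b)))
    (hpref : ∀ w, IsReducedExpression w (pref w)) :
    ∑ x : oddPairs a b, ((((x.1.1 - 1) / 2 : ℕ) : F) * (((a + b + 2 - x.1.2) / 2 : ℕ) : F)) •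
        tableauVector F ha pref (dominoTableau x)
      = weightedSum F (a + b) (A + B) B (spechtGen F a b ha) := by
  have key : ∀ x : oddPairs a b,
      ((((x.1.1 - 1) / 2 : ℕ) : F) * (((a + b + 2 - x.1.2) / 2 : ℕ) : F)) •
        tableauVector F ha pref (dominoTableau x)
      = (((x.1.1 - 1) / 2) * ((a + b + 2 - x.1.2) / 2)) •
          dominoVec F (a + b) B (spechtGen F a b ha) (B - (x.1.1 - 1) / 2)
            ((x.1.2 - 1) / 2 - B - 1) := by
    intro x
    obtain ⟨⟨⟨h1, h2⟩, h3, h4⟩, ⟨i, hi⟩, ⟨j, hj⟩⟩ := mem_oddPairs.1 x.2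
    have hs := isShuffle_dominoTableau (F := F) ha hA hB (spechtGen F a b ha)
      (l := B - (x.1.1 - 1) / 2) (m := (x.1.2 - 1) / 2 - B - 1) (by omega) (by omega) x
      (by omega) (by omega)
    rw [← Nat.cast_mul, tableauVector, hs.psiWord_smul (hpref _)]
    exact Nat.cast_smul_eq_nsmul F _ (dominoVec F (a + b) B (spechtGen F a b ha) _ _)
  refine (Finset.sum_congr rfl fun x _ => key x).trans
    ((Finset.sum_coe_sort (oddPairs a b) fun y : ℕ × ℕ =>
      (((y.1 - 1) / 2) * ((a + b + 2 - y.2) / 2)) •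
          dominoVec F (a + b) B (spechtGen F a b ha) (B - (y.1 - 1) / 2)
            ((y.2 - 1) / 2 - B - 1)).trans ?_)
  rw [weightedSum, ← Finset.sum_product']
  refine Finset.sum_nbij' (fun y => (B - (y.1 - 1) / 2, (y.2 - 1) / 2 - B - 1))
    (fun y => (2 * (B - y.1) + 1, 2 * (B + y.2 + 1) + 1)) ?_ ?_ ?_ ?_ ?_
  · intro y hy
    obtain ⟨⟨⟨h1, h2⟩, h3, h4⟩, ⟨i, hi⟩, ⟨j, hj⟩⟩ := mem_oddPairs.1 hy
    simp only [Finset.mem_product, Finset.mem_range]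
    omega
  · intro y hy
    simp only [Finset.mem_product, Finset.mem_range] at hy
    rw [mem_oddPairs]
    exact ⟨by simp only; omega, odd_two_mul_add_one _, odd_two_mul_add_one _⟩
  · intro y hy
    obtain ⟨⟨⟨h1, h2⟩, h3, h4⟩, ⟨i, hi⟩, ⟨j, hj⟩⟩ := mem_oddPairs.1 hy
    ext <;> simp only <;> omega
  · intro y hy
    simp only [Finset.mem_product, Finset.mem_range] at hy
    ext <;> simp only <;> omega
  · intro y hy
    obtain ⟨⟨⟨h1, h2⟩, h3, h4⟩, ⟨i, hi⟩, ⟨j, hj⟩⟩ := mem_oddPairs.1 hy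
    simp only
    congr 2 <;> omega

/-- The weighted sum satisfies the defining relations of the generator of the Specht module. -/
theorem smul_weightedSum_of_rel {A B : ℕ} (hA : a = 2 * A + 1) (hB : b = 2 * B)
    {h : KLR F (a + b)} (hh : SpechtRel F a b ha h) :
    h • weightedSum F (a + b) (A + B) B (spechtGen F a b ha) = 0 := by
  have hz := isDomino_spechtGen F ha hB
  have hz' : ∀ r, r ≠ 2 * B + 1 → psiN F (a + b) r • spechtGen F a b ha = 0 :=
    fun r hr => psi_smul_spechtGen F ha (by rwa [hB])
  obtain ⟨N, hN⟩ : ∃ N, N = A + B := ⟨_, rfl⟩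
  have hn : a + b = 2 * N + 1 := by omega
  -- the lemmas on weighted sums are stated for the algebra on `2 * N + 1` strands, so `a + b` is
  -- generalized to be substituted by it
  suffices H : ∀ (n : ℕ) (hn : n = 2 * N + 1) (M : Type _) [AddCommGroup M] [Module (KLR F n) M]
      (z : M), IsDomino F n z → (∀ r, r ≠ 2 * B + 1 → psiN F n r • z = 0) →
      IsDomino F n (weightedSum F n N B z) ∧ ∀ k, 1 ≤ k → 2 * k + 1 < n → k ≠ B →
        psiN F n (2 * k + 1) • weightedSum F n N B z = 0 by
    obtain ⟨h1, h2⟩ := H (a + b) hn _ _ hz hz'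
    rw [← hN]
    exact smul_eq_zero_of_rel ha hB h1 h2 hh
  rintro n rfl M _ _ z hz hz'
  exact ⟨isDomino_weightedSum hz, fun k hk hkn => psi_weightedSum hz hz' hk (by omega)⟩

end Main

end HookSpecht

theorem mainTheorem7 {F : Type*} [Field F] (a b : ℕ) (ha : Odd a) (hb : Even b)
    (pref : Equiv.Perm (HookSpecht.Pos (a + b)) → List (HookSpecht.Idx (a + b)))
    (hpref : ∀ w, HookSpecht.IsReducedExpression w (pref w)) :
    ∃ f : HookSpecht.Specht F a b ha.pos →ₗ[HookSpecht.KLR F (a + b)]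
        HookSpecht.Specht F a b ha.pos,
      f (HookSpecht.spechtGen F a b ha.pos) =
        ∑ x : HookSpecht.oddPairs a b,
          ((((x.1.1 - 1) / 2 : ℕ) : F) * (((a + b + 2 - x.1.2) / 2 : ℕ) : F)) •
            HookSpecht.tableauVector F ha.pos pref (HookSpecht.dominoTableau x) := by
  obtain ⟨A, hA⟩ := id ha
  obtain ⟨B, hB⟩ := hb.two_dvd
  rw [HookSpecht.sum_dominoTableau F _ hA hB pref hpref]
  refine ⟨Submodule.liftQ _ (LinearMap.toSpanSingleton _ _ (HookSpecht.weightedSum F (a + b) (A + B)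
    B (HookSpecht.spechtGen F a b ha.pos))) ?_, ?_⟩
  · refine Submodule.span_le.2 fun h hh => ?_
    exact HookSpecht.smul_weightedSum_of_rel F ha.pos hA hB hh
  · exact (Submodule.liftQ_apply _ _ _).trans (one_smul _ _)
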